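/- **Conventions.** All algebras are associative algebras over $\mathbb C$, with or without identity, with non-degenerate product ($ab=0$ for all $b$ implies $a=0$, and $ba=0$ for all $b$ implies $a=0$); $\otimes$ is the algebraic tensor product, and $\iota$ is the identity map. The multiplier algebra $M(C)$ of $C$ consists of the pairs of linear maps $y\mapsto my$, $y\mapsto ym$ of $C$ with $m(yy')=(my)y'$, $(yy')m=y(y'm)$ and $(ym)y'=y(my')$. A *regular multiplier Hopf algebra* is an algebra $A$ with a coassociative homomorphism $\Delta:A\to M(A\otimes A)$ such that $\Delta(a)(1\otimes b)$ and $(a\otimes 1)\Delta(b)$ lie in $A\otimes A$ and define bijections $a\otimes b\mapsto\Delta(a)(1\otimes b)$ and $a\otimes b\mapsto(a\otimes1)\Delta(b)$ of $A\otimes A$, and such that the same holds for $\Delta$ composed with the flip. It has a counit $\epsilon$ and a bijective antipode $S:A\to A$. We write $\Delta(a)=\sum a_{(1)}\otimes a_{(2)}$; all the expressions below make sense by covering. An *action* of $A$ on an algebra $R$ is a left $A$-module structure on $R$ with $AR=R$ (linear span) and $a(xx')=\sum (a_{(1)}x)(a_{(2)}x')$. The action extends to $M(R)$ by $(am)x=\sum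 a_{(1)}\bigl(m(S(a_{(2)})x)\bigr)$ and $x(am)=\sum a_{(2)}\bigl((S^{-1}(a_{(1)})x)m\bigr)$, and $m\in M(R)$ is a *fixed point* if $am=\epsilon(a)m$ for all $a\in A$. The *smash product* $R\# A$ is $R\otimes A$ with the product $(x\# a)(x'\# a')=\sum x(a_{(1)}x')\# a_{(2)}a'$. A *non-degenerate dual pair* $(A,B)$ of regular multiplier Hopf algebras carries a non-degenerate bilinear form $\langle\cdot,\cdot\rangle:A\times B\to\mathbb C$ such that, for all $a\in A$ and $b\in B$, the multipliers $b\triangleright a=\sum\langle a_{(2)},b\rangle a_{(1)}$ and $a\triangleleft b=\sum\langle a_{(1)},b\rangle a_{(2)}$ lie in $A$, the multipliers $a\triangleright b=\sum\langle a,b_{(2)}\rangle b_{(1)}$ and $b\triangleleft a=\sum\langle a,b_{(1)}\rangle b_{(2)}$ lie in $B$, and $$\langle b\triangleright a,b'\rangle=\langle a,b'b\rangle,\quad \langle a\triangleleft b,b'\rangle=\langle a,bb'\rangle,\quad \langle a',a\triangleright b\rangle=\langle a'a,b\rangle,\quad \langle a',b\triangleleft a\rangle=\langle aa',b\rangle ,$$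 and such that one (equivalently, each) of these four modules is unital (i.e. $B\triangleright A=A$, etc., as linear spans). **Proposition 7.3.** Let $(A,B)$ be a non-degenerate dual pair of regular multiplier Hopf algebras and let $A$ act on an algebra $R$ with non-degenerate product. Consider the dual action of $B$ on $R\# A$, given by $b(x\# a)=x\#(b\triangleright a)$. There is an injective unital algebra homomorphism $\pi:M(R)\to M(R\# A)$ with $$\pi(m)(x\# a)=mx\# a\qquad(m\in M(R),\ x\in R,\ a\in A)$$ (the canonical embedding, which this formula determines), and the fixed points in $M(R\# A)$ for the dual action are precisely the elements of $\pi(M(R))$; in particular they form a subalgebra. -/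

import Mathlib

open scoped TensorProduct

universe u v w

noncomputable section

/-! All algebras are associative algebras over `ℂ`, with or without identity. -/

/-- The product of `A` is non-degenerate as a bilinear map. -/
def NondegenerateProduct (A : Type u) [NonUnitalNonAssocRing A] : Prop :=
  (∀ a : A, (∀ b : A, a * b = 0) → a = 0) ∧ (∀ a : A, (∀ b : A, b * a = 0) → a = 0)

/-- The multiplier algebra `M(A)`: pairs `(l, r)` of linear maps of `A`, thought of as `l a = m a`
and `r a = a m`, such that `m (a b) = (m a) b`, `(a b) m = a (b m)` and `(a m) b = a (m b)`.
It is a unital algebra over `ℂ`; the right components compose in the opposite order. -/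
def multiplierAlgebra (A : Type u) [NonUnitalNonAssocRing A] [Module ℂ A]
    [IsScalarTower ℂ A A] [SMulCommClass ℂ A A] :
    Subalgebra ℂ (Module.End ℂ A × (Module.End ℂ A)ᵐᵒᵖ) where
  carrier := {z | (∀ a b : A, z.1 (a * b) = z.1 a * b) ∧
    (∀ a b : A, z.2.unop (a * b) = a * z.2.unop b) ∧
    (∀ a b : A, z.2.unop a * b = a * z.1 b)}
  mul_mem' := by
    rintro y z ⟨hy1, hy2, hy3⟩ ⟨hz1, hz2, hz3⟩
    refine ⟨fun a b => ?_, fun a b => ?_, fun a b => ?_⟩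
    · simp [hz1, hy1]
    · simp [hz2, hy2]
    · simp [hz3, hy3]
  add_mem' := by
    rintro y z ⟨hy1, hy2, hy3⟩ ⟨hz1, hz2, hz3⟩
    refine ⟨fun a b => ?_, fun a b => ?_, fun a b => ?_⟩
    · simp [hz1, hy1, add_mul]
    · simp [hz2, hy2, mul_add]
    · simp [hz3, hy3, add_mul, mul_add]
  algebraMap_mem' := by
    intro c
    refine ⟨fun a b => ?_, fun a b => ?_, fun a b => ?_⟩
    · simp [Module.algebraMap_end_apply, smul_mul_assoc]
    · simp [MulOpposite.algebraMap_apply, Module.algebraMap_end_apply, mul_smul_comm]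
    · simp [MulOpposite.algebraMap_apply, Module.algebraMap_end_apply, mul_smul_comm,
        smul_mul_assoc]

/-- The multiplier algebra `M(A)` as a type; it is a ring and a `ℂ`-algebra. -/
abbrev Multiplier (A : Type u) [NonUnitalNonAssocRing A] [Module ℂ A]
    [IsScalarTower ℂ A A] [SMulCommClass ℂ A A] : Type u :=
  ↥(multiplierAlgebra A)

namespace Multiplier

section
variable {A : Type u} [NonUnitalNonAssocRing A] [Module ℂ A]
  [IsScalarTower ℂ A A] [SMulCommClass ℂ A A]

/-- `a ↦ m a`. -/
def left (m : Multiplier A) : A →ₗ[ℂ] A := m.1.1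

/-- `a ↦ a m`. -/
def right (m : Multiplier A) : A →ₗ[ℂ] A := m.1.2.unop

theorem left_mul (m : Multiplier A) (a b : A) : m.left (a * b) = m.left a * b := m.2.1 a b

theorem right_mul (m : Multiplier A) (a b : A) : m.right (a * b) = a * m.right b := m.2.2.1 a b

theorem right_mul_eq (m : Multiplier A) (a b : A) : m.right a * b = a * m.left b := m.2.2.2 a b

/-- Constructor of multipliers. -/
def mk' (l r : A →ₗ[ℂ] A) (hl : ∀ a b, l (a * b) = l a * b) (hr : ∀ a b, r (a * b) = a * r b)
    (h : ∀ a b, r a * b = a * l b) : Multiplier A :=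
  ⟨(l, MulOpposite.op r), hl, hr, h⟩

end

/-- The canonical map `A → M(A)`. -/
def of {A : Type u} [NonUnitalRing A] [Module ℂ A]
    [IsScalarTower ℂ A A] [SMulCommClass ℂ A A] (a : A) : Multiplier A :=
  mk' (LinearMap.mulLeft ℂ a) (LinearMap.mulRight ℂ a)
    (fun b c => by simp [mul_assoc]) (fun b c => by simp [mul_assoc])
    (fun b c => by simp [mul_assoc])

section
variable {A : Type u} [NonUnitalRing A] [Module ℂ A]
  [IsScalarTower ℂ A A] [SMulCommClass ℂ A A]

/-- The multiplier `m ⊗ n` of `A ⊗ A`, for `m, n ∈ M(A)`. -/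
def tmul (m n : Multiplier A) : Multiplier (A ⊗[ℂ] A) :=
  mk' (TensorProduct.map m.left n.left) (TensorProduct.map m.right n.right)
    (fun s t => by
      induction s with
      | zero => simp
      | add x y hx hy => simp [add_mul, hx, hy]
      | tmul a b =>
        induction t with
        | zero => simp
        | add x y hx hy => simp [mul_add, hx, hy]
        | tmul c d => simp [left_mul])
    (fun s t => by
      induction s with
      | zero => simp
      | add x y hx hy => simp [add_mul, hx, hy]
      | tmul a b =>
        induction t with
        | zero => simp
        | add x y hx hy => simp [mul_add, hx, hy]
        | tmul c d => simp [right_mul])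
    (fun s t => by
      induction s with
      | zero => simp
      | add x y hx hy => simp [add_mul, hx, hy]
      | tmul a b =>
        induction t with
        | zero => simp
        | add x y hx hy => rw [mul_add, hx, hy, map_add, mul_add]
        | tmul c d => simp [right_mul_eq])

theorem comm_mul (s t : A ⊗[ℂ] A) : TensorProduct.comm ℂ A A (s * t) =
    TensorProduct.comm ℂ A A s * TensorProduct.comm ℂ A A t := by
  induction s with
  | zero => simp
  | add x y hx hy => simp [add_mul, hx, hy]
  | tmul a b =>
    induction t with
    | zero => simp
    | add x y hx hy => simp [mul_add, hx, hy]
    | tmul c d => simp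

/-- The extension to `M(A ⊗ A)` of the flip `a ⊗ b ↦ b ⊗ a` of `A ⊗ A`. -/
def flip (m : Multiplier (A ⊗[ℂ] A)) : Multiplier (A ⊗[ℂ] A) :=
  mk' ((TensorProduct.comm ℂ A A).toLinearMap ∘ₗ m.left ∘ₗ (TensorProduct.comm ℂ A A).toLinearMap)
    ((TensorProduct.comm ℂ A A).toLinearMap ∘ₗ m.right ∘ₗ (TensorProduct.comm ℂ A A).toLinearMap)
    (fun s t => by simp [comm_mul, left_mul]) (fun s t => by simp [comm_mul, right_mul])
    (fun s t => (TensorProduct.comm ℂ A A).injective (by simp [comm_mul, right_mul_eq]))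

end

end Multiplier

section
variable {A : Type u} [AddCommGroup A] [Module ℂ A]

/-- The slice map `ω ⊗ ι : A ⊗ A → A`. -/
def sliceLeft (ω : A →ₗ[ℂ] ℂ) : A ⊗[ℂ] A →ₗ[ℂ] A :=
  (TensorProduct.lid ℂ A).toLinearMap ∘ₗ ω.rTensor A

/-- The slice map `ι ⊗ ω : A ⊗ A → A`. -/
def sliceRight (ω : A →ₗ[ℂ] ℂ) : A ⊗[ℂ] A →ₗ[ℂ] A :=
  (TensorProduct.rid ℂ A).toLinearMap ∘ₗ ω.lTensor A

end

/-- A multiplier Hopf algebra structure on an algebra `A` with non-degenerate product: a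
homomorphism `Δ : A → M(A ⊗ A)` such that `Δ(a)(1 ⊗ b)` and `(a ⊗ 1)Δ(b)` belong to `A ⊗ A`,
which is coassociative, and such that the maps `T₁ : a ⊗ b ↦ Δ(a)(1 ⊗ b)` and
`T₂ : a ⊗ b ↦ (a ⊗ 1)Δ(b)` are bijections of `A ⊗ A`. As the canonical map from `A ⊗ A` to
`M(A ⊗ A)` is injective, `T₁` and `T₂` are determined by `Δ`. -/
structure MultiplierHopfAlgebra (A : Type u) [NonUnitalRing A] [Module ℂ A]
    [IsScalarTower ℂ A A] [SMulCommClass ℂ A A] where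
  nondegenerate : NondegenerateProduct A
  Δ : A →ₙₐ[ℂ] Multiplier (A ⊗[ℂ] A)
  T₁ : (A ⊗[ℂ] A) ≃ₗ[ℂ] (A ⊗[ℂ] A)
  T₁_spec : ∀ a b : A,
    Multiplier.of (T₁ (a ⊗ₜ b)) = Δ a * Multiplier.tmul 1 (Multiplier.of b)
  T₂ : (A ⊗[ℂ] A) ≃ₗ[ℂ] (A ⊗[ℂ] A)
  T₂_spec : ∀ a b : A,
    Multiplier.of (T₂ (a ⊗ₜ b)) = Multiplier.tmul (Multiplier.of a) 1 * Δ b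
  /-- `(a ⊗ 1 ⊗ 1)(Δ ⊗ ι)(Δ(b)(1 ⊗ c)) = (ι ⊗ Δ)((a ⊗ 1)Δ(b))(1 ⊗ 1 ⊗ c)` in `A ⊗ (A ⊗ A)`,
  where `(a ⊗ 1 ⊗ 1)(Δ ⊗ ι)(p ⊗ q) = (a ⊗ 1)Δ(p) ⊗ q` and
  `(ι ⊗ Δ)(p ⊗ q)(1 ⊗ 1 ⊗ c) = p ⊗ Δ(q)(1 ⊗ c)`. -/
  coassoc : ∀ a b c : A,
    TensorProduct.assoc ℂ A A A (T₂.toLinearMap.rTensor A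
      ((TensorProduct.assoc ℂ A A A).symm (a ⊗ₜ T₁ (b ⊗ₜ c)))) =
    T₁.toLinearMap.lTensor A (TensorProduct.assoc ℂ A A A (T₂ (a ⊗ₜ b) ⊗ₜ c))

/-- A regular multiplier Hopf algebra: also the opposite comultiplication, obtained by composing
`Δ` with the flip, makes `A` into a multiplier Hopf algebra. -/
structure RegularMultiplierHopfAlgebra (A : Type u) [NonUnitalRing A] [Module ℂ A]
    [IsScalarTower ℂ A A] [SMulCommClass ℂ A A] extends MultiplierHopfAlgebra A where
  cop : MultiplierHopfAlgebra A
  cop_Δ : ∀ a : A, cop.Δ a = Multiplier.flip (Δ a)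

namespace RegularMultiplierHopfAlgebra

variable {A : Type u} [NonUnitalRing A] [Module ℂ A] [IsScalarTower ℂ A A] [SMulCommClass ℂ A A]
  (H : RegularMultiplierHopfAlgebra A)

/-- `T₃ (a ⊗ b) = Δ(a)(b ⊗ 1)`, the flip of `Δ'(a)(1 ⊗ b)` for the opposite
comultiplication `Δ'`. -/
def T₃ : (A ⊗[ℂ] A) ≃ₗ[ℂ] (A ⊗[ℂ] A) := H.cop.T₁.trans (TensorProduct.comm ℂ A A)

/-- `T₄ (a ⊗ b) = (1 ⊗ a)Δ(b)`, the flip of `(a ⊗ 1)Δ'(b)` for the opposite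
comultiplication `Δ'`. -/
def T₄ : (A ⊗[ℂ] A) ≃ₗ[ℂ] (A ⊗[ℂ] A) := H.cop.T₂.trans (TensorProduct.comm ℂ A A)

/-- The defining property of the counit: `(ε ⊗ ι)(Δ(a)(1 ⊗ b)) = a b` and
`(ι ⊗ ε)((a ⊗ 1)Δ(b)) = a b`. -/
def IsCounit (ε : A →ₗ[ℂ] ℂ) : Prop :=
  ∀ a b : A, sliceLeft ε (H.T₁ (a ⊗ₜ b)) = a * b ∧ sliceRight ε (H.T₂ (a ⊗ₜ b)) = a * b

/-- The counit `ε`, the unique linear functional with the defining property. -/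
def counit : A →ₗ[ℂ] ℂ := Classical.epsilon H.IsCounit

/-- The defining property of the antipode: `m(S ⊗ ι)(Δ(a)(1 ⊗ b)) = ε(a) b` and
`m(ι ⊗ S)((a ⊗ 1)Δ(b)) = ε(b) a`. The antipode of a regular multiplier Hopf algebra maps `A`
bijectively onto `A`. -/
def IsAntipode (S : A ≃ₗ[ℂ] A) : Prop :=
  ∀ a b : A,
    TensorProduct.lift ((LinearMap.mul ℂ A).comp S.toLinearMap) (H.T₁ (a ⊗ₜ b)) =
      H.counit a • b ∧
    TensorProduct.lift ((LinearMap.mul ℂ A).compl₂ S.toLinearMap) (H.T₂ (a ⊗ₜ b)) =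
      H.counit b • a

/-- The antipode `S`, the unique linear bijection of `A` with the defining property. -/
def antipode : A ≃ₗ[ℂ] A := Classical.epsilon H.IsAntipode

/-- `c = (ω ⊗ ι)Δ(a) = ∑ ω(a₁) a₂`, as an equality of multipliers of `A`: multiplication
by `d` covers `a₂`. -/
def IsSliceLeft (ω : A →ₗ[ℂ] ℂ) (a c : A) : Prop :=
  ∀ d : A, c * d = sliceLeft ω (H.T₁ (a ⊗ₜ d)) ∧ d * c = sliceLeft ω (H.T₄ (d ⊗ₜ a))

/-- `c = (ι ⊗ ω)Δ(a) = ∑ ω(a₂) a₁`, as an equality of multipliers of `A`: multiplication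
by `d` covers `a₁`. -/
def IsSliceRight (ω : A →ₗ[ℂ] ℂ) (a c : A) : Prop :=
  ∀ d : A, c * d = sliceRight ω (H.T₃ (a ⊗ₜ d)) ∧ d * c = sliceRight ω (H.T₂ (d ⊗ₜ a))

end RegularMultiplierHopfAlgebra

/-- An action of a regular multiplier Hopf algebra `A` on an algebra `R`: a unital left `A`-module
structure (`AR = R`, the span of all `a x`) such that `a (x x') = ∑ (a₁ x)(a₂ x')`. The elements
`x'` are sums of elements `c y`, and the formula for `x' = c y` reads
`a (x (c y)) = ∑ (p x)(q y)` where `∑ p ⊗ q = Δ(a)(1 ⊗ c)`. -/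
structure ModuleAlgebra {A : Type u} [NonUnitalRing A] [Module ℂ A] [IsScalarTower ℂ A A]
    [SMulCommClass ℂ A A] (H : RegularMultiplierHopfAlgebra A)
    (R : Type v) [NonUnitalRing R] [Module ℂ R] [IsScalarTower ℂ R R] [SMulCommClass ℂ R R] where
  act : A →ₗ[ℂ] R →ₗ[ℂ] R
  mul_act : ∀ (a a' : A) (x : R), act (a * a') x = act a (act a' x)
  unital : Submodule.span ℂ {y : R | ∃ (a : A) (x : R), act a x = y} = ⊤
  act_mul : ∀ (a c : A) (x y : R), act a (x * act c y) =
    TensorProduct.lift ((LinearMap.mul ℂ R).compl₁₂ (act.flip x) (act.flip y)) (H.T₁ (a ⊗ₜ c))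

/-- The smash product `R # A`: the space `R ⊗ A`, with another product. -/
def SmashProduct {A : Type u} [NonUnitalRing A] [Module ℂ A] [IsScalarTower ℂ A A]
    [SMulCommClass ℂ A A] {H : RegularMultiplierHopfAlgebra A}
    {R : Type v} [NonUnitalRing R] [Module ℂ R] [IsScalarTower ℂ R R] [SMulCommClass ℂ R R]
    (_X : ModuleAlgebra H R) : Type (max u v) :=
  R ⊗[ℂ] A

namespace SmashProduct

variable {A : Type u} [NonUnitalRing A] [Module ℂ A] [IsScalarTower ℂ A A]
  [SMulCommClass ℂ A A] {H : RegularMultiplierHopfAlgebra A}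
  {R : Type v} [NonUnitalRing R] [Module ℂ R] [IsScalarTower ℂ R R] [SMulCommClass ℂ R R]
  (X : ModuleAlgebra H R)

instance : AddCommGroup (SmashProduct X) := inferInstanceAs (AddCommGroup (R ⊗[ℂ] A))

instance : Module ℂ (SmashProduct X) := inferInstanceAs (Module ℂ (R ⊗[ℂ] A))

/-- The element `x # a`. -/
def mk (x : R) (a : A) : SmashProduct X := (x ⊗ₜ[ℂ] a : R ⊗[ℂ] A)

/-- For fixed `x, a`, the map `x' ⊗ a' ↦ ∑ x (a₁ x') ⊗ a₂ a'`, where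
`∑ a₁ ⊗ a₂ a' = Δ(a)(1 ⊗ a')`. -/
def mulAux (x : R) (a : A) : R ⊗[ℂ] A →ₗ[ℂ] R ⊗[ℂ] A :=
  TensorProduct.lift (LinearMap.mk₂ ℂ
    (fun x' a' => ((LinearMap.mulLeft ℂ x) ∘ₗ X.act.flip x').rTensor A (H.T₁ (a ⊗ₜ a')))
    (fun x₁ x₂ a' => by simp [LinearMap.comp_add, LinearMap.rTensor_add])
    (fun c x' a' => by simp [LinearMap.comp_smul, LinearMap.rTensor_smul])
    (fun x' a₁ a₂ => by simp [TensorProduct.tmul_add])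
    (fun c x' a' => by simp))

theorem mulAux_tmul (x x' : R) (a a' : A) : mulAux X x a (x' ⊗ₜ a') =
    ((LinearMap.mulLeft ℂ x) ∘ₗ X.act.flip x').rTensor A (H.T₁ (a ⊗ₜ a')) := by
  simp [mulAux]

/-- The bilinear product `(x # a)(x' # a') = ∑ x (a₁ x') # a₂ a'`. -/
def mulTensor : R ⊗[ℂ] A →ₗ[ℂ] R ⊗[ℂ] A →ₗ[ℂ] R ⊗[ℂ] A :=
  TensorProduct.lift (LinearMap.mk₂ ℂ (mulAux X)
    (fun x₁ x₂ a => by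
      ext x' a'
      have h : LinearMap.mulLeft ℂ (x₁ + x₂) =
          LinearMap.mulLeft ℂ x₁ + LinearMap.mulLeft ℂ x₂ := by
        ext; simp [add_mul]
      simp [mulAux_tmul, h, LinearMap.add_comp, LinearMap.rTensor_add])
    (fun c x a => by
      ext x' a'
      have h : LinearMap.mulLeft ℂ (c • x) = c • LinearMap.mulLeft ℂ x := by
        ext; simp [smul_mul_assoc]
      simp [mulAux_tmul, h, LinearMap.smul_comp, LinearMap.rTensor_smul])
    (fun x a₁ a₂ => by ext x' a'; simp [mulAux_tmul, TensorProduct.add_tmul])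
    (fun c x a => by ext x' a'; simp [mulAux_tmul, ← TensorProduct.smul_tmul']))

theorem mulTensor_tmul (x x' : R) (a a' : A) : mulTensor X (x ⊗ₜ a) (x' ⊗ₜ a') =
    ((LinearMap.mulLeft ℂ x) ∘ₗ X.act.flip x').rTensor A (H.T₁ (a ⊗ₜ a')) := by
  simp [mulTensor, mulAux_tmul]

/-- The product of `R # A`. -/
def mulMap : SmashProduct X →ₗ[ℂ] SmashProduct X →ₗ[ℂ] SmashProduct X := mulTensor X

/-- The algebra structure of `R # A`. The product is associative, as a consequence of the module
algebra axioms and of coassociativity; this is not needed to form the multiplier algebra. -/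
instance : NonUnitalNonAssocRing (SmashProduct X) where
  mul s t := mulMap X s t
  left_distrib s t t' := map_add (mulMap X s) t t'
  right_distrib s s' t := by
    change mulMap X (s + s') t = mulMap X s t + mulMap X s' t
    rw [map_add, LinearMap.add_apply]
  zero_mul t := by
    change mulMap X 0 t = 0
    rw [map_zero, LinearMap.zero_apply]
  mul_zero s := map_zero (mulMap X s)

instance : IsScalarTower ℂ (SmashProduct X) (SmashProduct X) where
  smul_assoc c s t := by
    change mulMap X (c • s) t = c • mulMap X s t
    rw [map_smul, LinearMap.smul_apply]

instance : SMulCommClass ℂ (SmashProduct X) (SmashProduct X) where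
  smul_comm c s t := by
    change c • mulMap X s t = mulMap X s (c • t)
    rw [map_smul]

/-- The homomorphism `π : M(R) → M(R # A)` is the canonical one: `π(m)(x # a) = m x # a`.
As the product of `R # A` is non-degenerate, this formula determines `π`. -/
def IsCanonicalEmbedding (π : Multiplier R →ₐ[ℂ] Multiplier (SmashProduct X)) : Prop :=
  ∀ (m : Multiplier R) (x : R) (a : A), (π m).left (mk X x a) = mk X (m.left x) a

end SmashProduct

/-- A non-degenerate dual pair `(A, B)` of regular multiplier Hopf algebras: a non-degenerate
bilinear form such that the four multipliers `a ▷ b`, `b ◁ a` of `B` and `b ▷ a`, `a ◁ b` of `A`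
defined below belong to `B` and `A` respectively, such that the coproducts are dual to the products,
and such that one (equivalently, each) of the four resulting modules is unital. The four module maps
are determined by the form and the coproducts. -/
structure DualPair {A : Type u} [NonUnitalRing A] [Module ℂ A] [IsScalarTower ℂ A A]
    [SMulCommClass ℂ A A] {B : Type w} [NonUnitalRing B] [Module ℂ B] [IsScalarTower ℂ B B]
    [SMulCommClass ℂ B B] (HA : RegularMultiplierHopfAlgebra A)
    (HB : RegularMultiplierHopfAlgebra B) where
  form : A →ₗ[ℂ] B →ₗ[ℂ] ℂ
  nondegenerate_left : ∀ a : A, (∀ b : B, form a b = 0) → a = 0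
  nondegenerate_right : ∀ b : B, (∀ a : A, form a b = 0) → b = 0
  /-- `a ▷ b = ∑ ⟨a, b₂⟩ b₁` -/
  leftA : A →ₗ[ℂ] B →ₗ[ℂ] B
  leftA_spec : ∀ (a : A) (b : B), HB.IsSliceRight (form a) b (leftA a b)
  /-- `b ◁ a = ∑ ⟨a, b₁⟩ b₂` -/
  rightA : A →ₗ[ℂ] B →ₗ[ℂ] B
  rightA_spec : ∀ (a : A) (b : B), HB.IsSliceLeft (form a) b (rightA a b)
  /-- `b ▷ a = ∑ ⟨a₂, b⟩ a₁` -/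
  leftB : B →ₗ[ℂ] A →ₗ[ℂ] A
  leftB_spec : ∀ (b : B) (a : A), HA.IsSliceRight (form.flip b) a (leftB b a)
  /-- `a ◁ b = ∑ ⟨a₁, b⟩ a₂` -/
  rightB : B →ₗ[ℂ] A →ₗ[ℂ] A
  rightB_spec : ∀ (b : B) (a : A), HA.IsSliceLeft (form.flip b) a (rightB b a)
  form_leftA : ∀ (a a' : A) (b : B), form a' (leftA a b) = form (a' * a) b
  form_rightA : ∀ (a a' : A) (b : B), form a' (rightA a b) = form (a * a') b
  form_leftB : ∀ (a : A) (b b' : B), form (leftB b a) b' = form a (b' * b)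
  form_rightB : ∀ (a : A) (b b' : B), form (rightB b a) b' = form a (b * b')
  unital : Submodule.span ℂ {y : B | ∃ (a : A) (b : B), leftA a b = y} = ⊤ ∨
    Submodule.span ℂ {y : B | ∃ (a : A) (b : B), rightA a b = y} = ⊤ ∨
    Submodule.span ℂ {y : A | ∃ (b : B) (a : A), leftB b a = y} = ⊤ ∨
    Submodule.span ℂ {y : A | ∃ (b : B) (a : A), rightB b a = y} = ⊤

/-- The dual action of `B` on `R # A`: `b (x # a) = x # (b ▷ a)`. -/
def dualAction {A : Type u} [NonUnitalRing A] [Module ℂ A] [IsScalarTower ℂ A A]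
    [SMulCommClass ℂ A A] {B : Type w} [NonUnitalRing B] [Module ℂ B] [IsScalarTower ℂ B B]
    [SMulCommClass ℂ B B] {HA : RegularMultiplierHopfAlgebra A}
    {HB : RegularMultiplierHopfAlgebra B} (P : DualPair HA HB)
    {R : Type v} [NonUnitalRing R] [Module ℂ R] [IsScalarTower ℂ R R] [SMulCommClass ℂ R R]
    (X : ModuleAlgebra HA R) : B →ₗ[ℂ] SmashProduct X →ₗ[ℂ] SmashProduct X :=
  (LinearMap.lTensorHom R ∘ₗ P.leftB : B →ₗ[ℂ] R ⊗[ℂ] A →ₗ[ℂ] R ⊗[ℂ] A)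

section FixedPoints

variable {B : Type u} [NonUnitalRing B] [Module ℂ B] [IsScalarTower ℂ B B]
  [SMulCommClass ℂ B B] (H : RegularMultiplierHopfAlgebra B)
  {C : Type v} [NonUnitalNonAssocRing C] [Module ℂ C] [IsScalarTower ℂ C C] [SMulCommClass ℂ C C]
  (act : B →ₗ[ℂ] C →ₗ[ℂ] C)

/-- `n = b m` for the extension to `M(C)` of an action of `B` on `C`, which is given by
`(b m) x = ∑ b₁ (m (S(b₂) x))` and `x (b m) = ∑ b₂ ((S⁻¹(b₁) x) m)`.
To cover `b₂` in the first formula, take `x = S(c) y`; then `S(b₂) x = S(c b₂) y`, and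
`∑ b₁ ⊗ c b₂ = (1 ⊗ c)Δ(b)` lies in `B ⊗ B`. To cover `b₁` in the second one, take `x = S⁻¹(c) y`;
then `S⁻¹(b₁) x = S⁻¹(c b₁) y`, and `∑ c b₁ ⊗ b₂ = (c ⊗ 1)Δ(b)` lies in `B ⊗ B`. For a unital
action the elements `S(c) y`, and also the elements `S⁻¹(c) y`, span `C`. -/
def IsExtendedAction (b : B) (m n : Multiplier C) : Prop :=
  ∀ (c : B) (y : C),
    n.left (act (H.antipode c) y) =
      TensorProduct.lift (act.compl₂ (m.left ∘ₗ act.flip y ∘ₗ H.antipode.toLinearMap))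
        (H.T₄ (c ⊗ₜ b)) ∧
    n.right (act (H.antipode.symm c) y) =
      TensorProduct.lift (act.compl₂ (m.right ∘ₗ act.flip y ∘ₗ H.antipode.symm.toLinearMap)).flip
        (H.T₂ (c ⊗ₜ b))

/-- Fixed points in `M(C)`: the `m ∈ M(C)` such that `b m = ε(b) m` for all `b`. -/
def fixedPoints : Set (Multiplier C) :=
  {m | ∀ b : B, IsExtendedAction H act b m (H.counit b • m)}

end FixedPoints

end

/-! An element of R # A can be written as a sum of x # a or, through the bijection `cross`, as a sum
of (1 # a)(x # 1) = ∑ a₁x # a₂. A multiplier m of R acts from the left on the first form by x ↦ mx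
and from the right on the second by x ↦ xm. That the two are compatible rests on (1 # a)(x # 1)(x' #
1) = (1 # a)(xx' # 1) (`rightMul_cross`), which combines the module algebra axiom with the pentagon
equation.

Being fixed means commuting with the action: since T₁ is bijective and its inverse is expressed by
S, the identity ∑ b₁(m(S(b₂)x)) = ε(b)mx for all b amounts to b(mx) = m(bx) on elements x = dy
(`invariant_iff`). The condition on right multiplication is the same statement for the opposite
comultiplication. Now π(m) is fixed because b ▷ acts on the leg A only, and it passes through
`cross` since Δ(b ▷ a) = (ι ⊗ b ▷)Δ(a).

Conversely, left multiplication F by a fixed point commutes with right multiplication by A and,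
because B ▷ A = A (`span_leftB`), with every b ▷. Slicing away the leg R leaves linear maps of A
commuting with both, and these are scalars (`exists_eq_smul_of_commute`). Hence F = f ⊗ ι. The right
component, conjugated by `cross` and sliced over A, yields g with g(x)y = x f(y), so (f, g) is a
multiplier of R (`exists_embed_eq`).

Counit and antipode are given by `Classical.epsilon`, so their existence has to be derived from the
bijectivity of the canonical maps, coassociativity and regularity. -/

noncomputable section

/-! ### Separating elements of tensor products. -/

namespace TensorProduct

variable {V : Type u} {W : Type v} {W' : Type w} [AddCommGroup V] [Module ℂ V]
  [AddCommGroup W] [Module ℂ W] [AddCommGroup W'] [Module ℂ W']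

/-- The slice maps `ω ⊗ ι` separate the elements of `V ⊗ W`. -/
theorem eq_of_slice_left {s t : V ⊗[ℂ] W}
    (h : ∀ ω : V →ₗ[ℂ] ℂ, TensorProduct.lid ℂ W (ω.rTensor W s) =
      TensorProduct.lid ℂ W (ω.rTensor W t)) : s = t := by
  classical
  let b := Module.Basis.ofVectorSpace ℂ V
  apply (TensorProduct.equivFinsuppOfBasisLeft (N := W) b).injective
  ext i
  have key : ∀ u : V ⊗[ℂ] W, TensorProduct.equivFinsuppOfBasisLeft b u i =
      TensorProduct.lid ℂ W ((b.coord i).rTensor W u) := by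
    intro u
    induction u with
    | zero => simp
    | add x y hx hy => simp [hx, hy]
    | tmul x y => simp
  rw [key, key, h]

theorem lTensor_rTensor {V' : Type*} [AddCommGroup V'] [Module ℂ V'] (f : V →ₗ[ℂ] V')
    (g : W →ₗ[ℂ] W') (t : V ⊗[ℂ] W) :
    g.lTensor V' (f.rTensor W t) = f.rTensor W' (g.lTensor V t) := by
  rw [← LinearMap.comp_apply, LinearMap.lTensor_comp_rTensor, ← LinearMap.rTensor_comp_lTensor,
    LinearMap.comp_apply]

theorem comm_rTensor (f : V →ₗ[ℂ] W') (t : V ⊗[ℂ] W) :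
    TensorProduct.comm ℂ W' W (f.rTensor W t) = f.lTensor W (TensorProduct.comm ℂ V W t) := by
  induction t with
  | zero => simp
  | add x y hx hy => simp only [map_add, hx, hy]
  | tmul x y => simp

theorem comm_lTensor (f : V →ₗ[ℂ] W') (t : W ⊗[ℂ] V) :
    TensorProduct.comm ℂ W W' (f.lTensor W t) = f.rTensor W (TensorProduct.comm ℂ W V t) := by
  induction t with
  | zero => simp
  | add x y hx hy => simp only [map_add, hx, hy]
  | tmul x y => simp

/-- A jointly injective family of maps of `W` remains so on `V ⊗ W`. -/
theorem eq_of_lTensor {ι : Type*} (g : ι → W →ₗ[ℂ] W') (hg : ∀ x, (∀ i, g i x = 0) → x = 0)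
    {s t : V ⊗[ℂ] W} (h : ∀ i, (g i).lTensor V s = (g i).lTensor V t) : s = t := by
  apply eq_of_slice_left
  intro ω
  rw [← sub_eq_zero]
  apply hg
  intro i
  have key : ∀ u : V ⊗[ℂ] W, g i (TensorProduct.lid ℂ W (ω.rTensor W u)) =
      TensorProduct.lid ℂ W' (ω.rTensor W' ((g i).lTensor V u)) := by
    intro u
    induction u with
    | zero => simp
    | add x y hx hy => simp [hx, hy]
    | tmul x y => simp
  rw [map_sub, key, key, h, sub_self]

/-- A jointly injective family of maps of `W` remains so on `W ⊗ V`. -/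
theorem eq_of_rTensor {ι : Type*} (g : ι → W →ₗ[ℂ] W') (hg : ∀ x, (∀ i, g i x = 0) → x = 0)
    {s t : W ⊗[ℂ] V} (h : ∀ i, (g i).rTensor V s = (g i).rTensor V t) : s = t := by
  apply (TensorProduct.comm ℂ W V).injective
  refine eq_of_lTensor g hg fun i => ?_
  rw [← comm_rTensor, ← comm_rTensor, h]

end TensorProduct

namespace NondegenerateProduct

variable {A : Type u} [NonUnitalRing A] [Module ℂ A]
  {V : Type v} [AddCommGroup V] [Module ℂ V]

theorem eq_of_mulRight_lTensor [IsScalarTower ℂ A A]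
    (h : NondegenerateProduct A) {s t : V ⊗[ℂ] A}
    (H : ∀ b, (LinearMap.mulRight ℂ b).lTensor V s = (LinearMap.mulRight ℂ b).lTensor V t) :
    s = t :=
  TensorProduct.eq_of_lTensor (fun b : A => LinearMap.mulRight ℂ b)
    (fun x hx => h.1 x fun b => by simpa using hx b) H

theorem eq_of_mulRight_rTensor [IsScalarTower ℂ A A]
    (h : NondegenerateProduct A) {s t : A ⊗[ℂ] V}
    (H : ∀ b, (LinearMap.mulRight ℂ b).rTensor V s = (LinearMap.mulRight ℂ b).rTensor V t) :
    s = t :=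
  TensorProduct.eq_of_rTensor (fun b : A => LinearMap.mulRight ℂ b)
    (fun x hx => h.1 x fun b => by simpa using hx b) H

theorem eq_of_mulLeft_rTensor [SMulCommClass ℂ A A]
    (h : NondegenerateProduct A) {s t : A ⊗[ℂ] V}
    (H : ∀ b, (LinearMap.mulLeft ℂ b).rTensor V s = (LinearMap.mulLeft ℂ b).rTensor V t) :
    s = t :=
  TensorProduct.eq_of_rTensor (fun b : A => LinearMap.mulLeft ℂ b)
    (fun x hx => h.2 x fun b => by simpa using hx b) H

theorem eq_of_mul_tmul [IsScalarTower ℂ A A] [SMulCommClass ℂ A A]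
    (h : NondegenerateProduct A) {s t : A ⊗[ℂ] A}
    (H : ∀ p q : A, s * (p ⊗ₜ q) = t * (p ⊗ₜ q)) : s = t := by
  have key : ∀ (p q : A) (u : A ⊗[ℂ] A), (LinearMap.mulRight ℂ p).rTensor A
      ((LinearMap.mulRight ℂ q).lTensor A u) = u * (p ⊗ₜ q) := by
    intro p q u
    induction u with
    | zero => simp
    | add x y hx hy => simp [hx, hy, add_mul]
    | tmul x y => simp
  refine h.eq_of_mulRight_lTensor fun q => h.eq_of_mulRight_rTensor fun p => ?_
  rw [key, key, H]

theorem eq_of_tmul_mul [IsScalarTower ℂ A A] [SMulCommClass ℂ A A]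
    (h : NondegenerateProduct A) {s t : A ⊗[ℂ] A}
    (H : ∀ p q : A, (p ⊗ₜ q) * s = (p ⊗ₜ q) * t) : s = t := by
  have key : ∀ (p q : A) (u : A ⊗[ℂ] A), (LinearMap.mulLeft ℂ p).rTensor A
      ((LinearMap.mulLeft ℂ q).lTensor A u) = (p ⊗ₜ q) * u := by
    intro p q u
    induction u with
    | zero => simp
    | add x y hx hy => simp [hx, hy, mul_add]
    | tmul x y => simp
  refine TensorProduct.eq_of_lTensor (fun b : A => LinearMap.mulLeft ℂ b)
    (fun x hx => h.2 x fun b => by simpa using hx b) fun q =>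
    h.eq_of_mulLeft_rTensor fun p => ?_
  rw [key, key, H]

end NondegenerateProduct

/-! ### The canonical maps T₁, T₂ and the existence of the counit. -/

namespace MultiplierHopfAlgebra

variable {A : Type u} [NonUnitalRing A] [Module ℂ A] [IsScalarTower ℂ A A] [SMulCommClass ℂ A A]
  (H : MultiplierHopfAlgebra A)

/-- This turns an identity between multipliers into one inside A ⊗ A; identities for T₁ then follow
by multiplying by p ⊗ q and cancelling. -/
theorem T₁_mul (a b : A) (t : A ⊗[ℂ] A) :
    H.T₁ (a ⊗ₜ b) * t = (H.Δ a).left ((LinearMap.mulLeft ℂ b).lTensor A t) := by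
  have h := congrArg (fun m => Multiplier.left m t) (H.T₁_spec a b)
  exact h

theorem mul_T₂ (a b : A) (t : A ⊗[ℂ] A) :
    t * H.T₂ (a ⊗ₜ b) = (H.Δ b).right ((LinearMap.mulRight ℂ a).rTensor A t) := by
  have h := congrArg (fun m => Multiplier.right m t) (H.T₂_spec a b)
  exact h

theorem T₂_mul (a b : A) (t : A ⊗[ℂ] A) :
    H.T₂ (a ⊗ₜ b) * t = (LinearMap.mulLeft ℂ a).rTensor A ((H.Δ b).left t) := by
  have h := congrArg (fun m => Multiplier.left m t) (H.T₂_spec a b)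
  exact h

/-- `Δ(a)(p ⊗ b) = (Δ(a)(1 ⊗ b))(p ⊗ 1)`. -/
theorem Δ_left_tmul (a p b : A) :
    (H.Δ a).left (p ⊗ₜ b) = (LinearMap.mulRight ℂ p).rTensor A (H.T₁ (a ⊗ₜ b)) := by
  refine H.nondegenerate.eq_of_mul_tmul fun x y => ?_
  have key : ∀ u : A ⊗[ℂ] A, (LinearMap.mulRight ℂ p).rTensor A u * (x ⊗ₜ y) =
      u * ((p * x) ⊗ₜ y) := by
    intro u
    induction u with
    | zero => simp
    | add x y hx hy => simp [hx, hy, add_mul]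
    | tmul x y => simp [mul_assoc]
  rw [key, T₁_mul, ← Multiplier.left_mul]
  simp

/-- `(a ⊗ q)Δ(b) = (1 ⊗ q)((a ⊗ 1)Δ(b))`. -/
theorem Δ_right_tmul (a q b : A) :
    (H.Δ b).right (a ⊗ₜ q) = (LinearMap.mulLeft ℂ q).lTensor A (H.T₂ (a ⊗ₜ b)) := by
  refine H.nondegenerate.eq_of_tmul_mul fun x y => ?_
  have key : ∀ u : A ⊗[ℂ] A, (x ⊗ₜ y) * (LinearMap.mulLeft ℂ q).lTensor A u =
      (x ⊗ₜ (y * q)) * u := by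
    intro u
    induction u with
    | zero => simp
    | add x y hx hy => simp only [map_add, mul_add, hx, hy]
    | tmul x y => simp [mul_assoc]
  rw [key, mul_T₂, ← Multiplier.right_mul]
  simp

/-- `(a ⊗ 1)(Δ(b)(1 ⊗ c)) = ((a ⊗ 1)Δ(b))(1 ⊗ c)`. -/
theorem mulLeft_T₁ (a b c : A) : (LinearMap.mulLeft ℂ a).rTensor A (H.T₁ (b ⊗ₜ c)) =
    (LinearMap.mulRight ℂ c).lTensor A (H.T₂ (a ⊗ₜ b)) := by
  refine H.nondegenerate.eq_of_mul_tmul fun x y => ?_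
  have key : ∀ u : A ⊗[ℂ] A, (LinearMap.mulRight ℂ c).lTensor A u * (x ⊗ₜ y) =
      u * (x ⊗ₜ (c * y)) := by
    intro u
    induction u with
    | zero => simp
    | add x y hx hy => simp [hx, hy, add_mul]
    | tmul x y => simp [mul_assoc]
  have key' : ∀ u : A ⊗[ℂ] A, (LinearMap.mulLeft ℂ a).rTensor A u * (x ⊗ₜ y) =
      (LinearMap.mulLeft ℂ a).rTensor A (u * (x ⊗ₜ y)) := by
    intro u
    induction u with
    | zero => simp
    | add x y hx hy => simp [hx, hy, add_mul]
    | tmul x y => simp [mul_assoc]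
  rw [key, key', T₁_mul, T₂_mul]
  simp

theorem T₁_mulRight (a : A) (b c : A) :
    H.T₁ (a ⊗ₜ (b * c)) = (LinearMap.mulRight ℂ c).lTensor A (H.T₁ (a ⊗ₜ b)) := by
  refine H.nondegenerate.eq_of_mul_tmul fun x y => ?_
  have key : ∀ u : A ⊗[ℂ] A, (LinearMap.mulRight ℂ c).lTensor A u * (x ⊗ₜ y) =
      u * (x ⊗ₜ (c * y)) := by
    intro u
    induction u with
    | zero => simp
    | add x y hx hy => simp [hx, hy, add_mul]
    | tmul x y => simp [mul_assoc]
  rw [key, T₁_mul, T₁_mul]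
  simp

theorem T₁_lTensor_mulRight (c : A) (t : A ⊗[ℂ] A) :
    H.T₁ ((LinearMap.mulRight ℂ c).lTensor A t) = (LinearMap.mulRight ℂ c).lTensor A (H.T₁ t) := by
  induction t with
  | zero => simp
  | add x y hx hy => simp [hx, hy]
  | tmul x y => simp [T₁_mulRight]

/-- `Δ(a b)(1 ⊗ c) = Δ(a)(Δ(b)(1 ⊗ c))`. -/
theorem T₁_mul_tmul (a b c : A) : H.T₁ ((a * b) ⊗ₜ c) = (H.Δ a).left (H.T₁ (b ⊗ₜ c)) := by
  refine H.nondegenerate.eq_of_mul_tmul fun x y => ?_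
  rw [T₁_mul, ← Multiplier.left_mul, T₁_mul, map_mul]
  rfl

/-- `(p ⊗ 1)(Δ(b a)) = ((p ⊗ 1)Δ(b))Δ(a)`. -/
theorem T₂_tmul_mul (p a b : A) : H.T₂ (p ⊗ₜ (b * a)) = (H.Δ a).right (H.T₂ (p ⊗ₜ b)) := by
  refine H.nondegenerate.eq_of_tmul_mul fun x y => ?_
  rw [mul_T₂, ← Multiplier.right_mul, mul_T₂, map_mul]
  rfl

theorem T₁_rTensor_mulLeft (a : A) (t : A ⊗[ℂ] A) :
    H.T₁ ((LinearMap.mulLeft ℂ a).rTensor A t) = (H.Δ a).left (H.T₁ t) := by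
  induction t with
  | zero => simp
  | add x y hx hy => simp [hx, hy]
  | tmul x y => simp [T₁_mul_tmul]

theorem T₂_lTensor_mulRight (a : A) (t : A ⊗[ℂ] A) :
    H.T₂ ((LinearMap.mulRight ℂ a).lTensor A t) = (H.Δ a).right (H.T₂ t) := by
  induction t with
  | zero => simp
  | add x y hx hy => simp [hx, hy]
  | tmul x y => simp [T₂_tmul_mul]

/-- Coassociativity: `(a ⊗ 1 ⊗ 1)(Δ ⊗ ι)(T₁ t) = (ι ⊗ T₁)((a ⊗ 1)Δ ⊗ ι) t`. -/
theorem assoc_T₂_T₁ (a : A) (t : A ⊗[ℂ] A) :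
    TensorProduct.assoc ℂ A A A
      ((H.T₂.toLinearMap ∘ₗ TensorProduct.mk ℂ A A a).rTensor A (H.T₁ t)) =
    H.T₁.toLinearMap.lTensor A (TensorProduct.assoc ℂ A A A
      ((H.T₂.toLinearMap ∘ₗ TensorProduct.mk ℂ A A a).rTensor A t)) := by
  induction t with
  | zero => simp
  | add x y hx hy => simp only [map_add, hx, hy]
  | tmul b c =>
    have h := H.coassoc a b c
    have key : ∀ u : A ⊗[ℂ] A, H.T₂.toLinearMap.rTensor A
        ((TensorProduct.assoc ℂ A A A).symm (a ⊗ₜ u)) =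
        (H.T₂.toLinearMap ∘ₗ TensorProduct.mk ℂ A A a).rTensor A u := by
      intro u
      induction u with
      | zero => simp
      | add x y hx hy => simp [hx, hy, TensorProduct.tmul_add]
      | tmul x y => simp
    rw [← key, h]
    simp

/-- Coassociativity with T₁ moved to the other side. Applying the product or ε ⊗ ι to the last two
legs yields respectively the counit and the formula for T₁⁻¹ in terms of the antipode. -/
theorem T₁_symm_coassoc (a : A) (t : A ⊗[ℂ] A) :
    H.T₁.symm.toLinearMap.lTensor A (TensorProduct.assoc ℂ A A A
      ((H.T₂.toLinearMap ∘ₗ TensorProduct.mk ℂ A A a).rTensor A t)) =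
    TensorProduct.assoc ℂ A A A
      ((H.T₂.toLinearMap ∘ₗ TensorProduct.mk ℂ A A a).rTensor A (H.T₁.symm t)) := by
  obtain ⟨t, rfl⟩ := H.T₁.surjective t
  rw [assoc_T₂_T₁, LinearEquiv.symm_apply_apply, ← LinearMap.lTensor_comp_apply]
  simp

/-- `(ι ⊗ m T₁⁻¹)(T₂ (a ⊗ b) ⊗ c) = a b ⊗ c`. -/
theorem T₂_mul_T₁_symm (a b c : A) :
    (LinearMap.mul' ℂ A ∘ₗ H.T₁.symm.toLinearMap).lTensor A
      (TensorProduct.assoc ℂ A A A (H.T₂ (a ⊗ₜ b) ⊗ₜ c)) = (a * b) ⊗ₜ c := by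
  have h := congrArg ((LinearMap.mul' ℂ A).lTensor A) (H.T₁_symm_coassoc a (b ⊗ₜ c))
  rw [← LinearMap.lTensor_comp_apply, LinearMap.rTensor_tmul] at h
  refine h.trans ?_
  have key : ∀ u : A ⊗[ℂ] A, (LinearMap.mul' ℂ A).lTensor A (TensorProduct.assoc ℂ A A A
      ((H.T₂.toLinearMap ∘ₗ TensorProduct.mk ℂ A A a).rTensor A u)) =
      (LinearMap.mulLeft ℂ a).rTensor A (H.T₁ u) := by
    intro u
    induction u with
    | zero => simp
    | add x y hx hy => simp only [map_add, hx, hy]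
    | tmul x y =>
      rw [mulLeft_T₁]
      simp only [LinearMap.rTensor_tmul, LinearMap.comp_apply, TensorProduct.mk_apply,
        LinearEquiv.coe_coe]
      induction H.T₂ (a ⊗ₜ x) with
      | zero => simp
      | add x y hx hy => simp only [TensorProduct.add_tmul, map_add, hx, hy]
      | tmul x y => simp
  rw [key]
  simp

/-- The counit exists: `m T₁⁻¹ (a ⊗ b) = ε(a) b` and `m T₂⁻¹ (a ⊗ b) = ε(b) a`. -/
theorem exists_counit : ∃ ε : A →ₗ[ℂ] ℂ,
    (∀ a b, LinearMap.mul' ℂ A (H.T₁.symm (a ⊗ₜ b)) = ε a • b) ∧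
    (∀ a b, LinearMap.mul' ℂ A (H.T₂.symm (a ⊗ₜ b)) = ε b • a) := by
  rcases subsingleton_or_nontrivial A with hA | hA
  · exact ⟨0, fun a b => Subsingleton.elim _ _, fun a b => Subsingleton.elim _ _⟩
  -- The first leg on the left is p and the last leg on the right is c, so both sides must be a
  -- multiple of p ⊗ c; the factor is ε(q).
  have h : ∀ p q c : A, p ⊗ₜ[ℂ] LinearMap.mul' ℂ A (H.T₁.symm (q ⊗ₜ c)) =
      LinearMap.mul' ℂ A (H.T₂.symm (p ⊗ₜ q)) ⊗ₜ c := by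
    have key : ∀ (u : A ⊗[ℂ] A) (c : A), (LinearMap.mul' ℂ A ∘ₗ H.T₁.symm.toLinearMap).lTensor A
      (TensorProduct.assoc ℂ A A A (H.T₂ u ⊗ₜ c)) = LinearMap.mul' ℂ A u ⊗ₜ c := by
      intro u c
      induction u with
      | zero => simp
      | add x y hx hy => simp only [map_add, TensorProduct.add_tmul, hx, hy]
      | tmul x y => rw [T₂_mul_T₁_symm]; simp
    intro p q c
    have := key (H.T₂.symm (p ⊗ₜ q)) c
    rw [← this]
    simp
  -- Slicing the identity by φ on the leg p reads off the factor, with φ(p)⁻¹ as normalisation.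
  obtain ⟨p, hp⟩ := exists_ne (0 : A)
  obtain ⟨φ, hφ⟩ := Module.Projective.exists_dual_ne_zero ℂ hp
  have hε : ∀ q c, LinearMap.mul' ℂ A (H.T₁.symm (q ⊗ₜ c)) =
      ((φ p)⁻¹ * φ (LinearMap.mul' ℂ A (H.T₂.symm (p ⊗ₜ q)))) • c := by
    intro q c
    have := congrArg (TensorProduct.lid ℂ A ∘ φ.rTensor A) (h p q c)
    simp only [Function.comp_apply, LinearMap.rTensor_tmul, TensorProduct.lid_tmul] at this
    rw [mul_smul, ← this, smul_smul, inv_mul_cancel₀ hφ, one_smul]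
  refine ⟨(φ p)⁻¹ • (φ ∘ₗ LinearMap.mul' ℂ A ∘ₗ H.T₂.symm.toLinearMap ∘ₗ
    TensorProduct.mk ℂ A A p), fun q c => ?_, fun p' q => ?_⟩
  · simp [hε]
  · have h1 := h p' q p
    rw [hε, ← TensorProduct.smul_tmul] at h1
    have := congrArg (TensorProduct.rid ℂ A ∘ φ.lTensor A) h1
    simp only [Function.comp_apply, LinearMap.lTensor_tmul, TensorProduct.rid_tmul] at this
    have h2 := congrArg ((φ p)⁻¹ • ·) this
    simp only [smul_smul, inv_mul_cancel₀ hφ, one_smul] at h2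
    simp only [LinearMap.smul_apply, LinearMap.comp_apply, TensorProduct.mk_apply,
      LinearEquiv.coe_coe, smul_eq_mul]
    rw [← h2, inv_mul_cancel_left₀ hφ]

end MultiplierHopfAlgebra

theorem sliceLeft_tmul {A : Type u} [AddCommGroup A] [Module ℂ A]
    (ω : A →ₗ[ℂ] ℂ) (a b : A) : sliceLeft ω (a ⊗ₜ b) = ω a • b := by
  simp [sliceLeft]

theorem sliceRight_tmul {A : Type u} [AddCommGroup A] [Module ℂ A]
    (ω : A →ₗ[ℂ] ℂ) (a b : A) : sliceRight ω (a ⊗ₜ b) = ω b • a := by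
  simp [sliceRight]

/-! ### Regularity: the four canonical maps, the counit and the antipode. -/

namespace RegularMultiplierHopfAlgebra

variable {A : Type u} [NonUnitalRing A] [Module ℂ A] [IsScalarTower ℂ A A] [SMulCommClass ℂ A A]

/-- The regular multiplier Hopf algebra with the opposite comultiplication. -/
def opp (H : RegularMultiplierHopfAlgebra A) : RegularMultiplierHopfAlgebra A where
  toMultiplierHopfAlgebra := H.cop
  cop := H.toMultiplierHopfAlgebra
  cop_Δ a := by
    rw [H.cop_Δ]
    apply Subtype.ext
    apply Prod.ext
    · ext1
      ext x
      simp [Multiplier.left, Multiplier.flip, Multiplier.mk']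
    · apply MulOpposite.unop_injective
      ext x
      simp [Multiplier.right, Multiplier.flip, Multiplier.mk']

variable (H : RegularMultiplierHopfAlgebra A)

theorem T₃_apply (t : A ⊗[ℂ] A) : H.T₃ t = TensorProduct.comm ℂ A A (H.opp.T₁ t) := rfl

theorem T₄_apply (t : A ⊗[ℂ] A) : H.T₄ t = TensorProduct.comm ℂ A A (H.opp.T₂ t) := rfl

theorem opp_T₄_apply (t : A ⊗[ℂ] A) : H.opp.T₄ t = TensorProduct.comm ℂ A A (H.T₂ t) := rfl

/-- `Δ(a)(p ⊗ b) = (Δ(a)(p ⊗ 1))(1 ⊗ b)`. -/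
theorem Δ_left_tmul' (a p b : A) :
    (H.Δ a).left (p ⊗ₜ b) = (LinearMap.mulRight ℂ b).lTensor A (H.T₃ (a ⊗ₜ p)) := by
  have h := H.cop.Δ_left_tmul a b p
  rw [H.cop_Δ] at h
  apply (TensorProduct.comm ℂ A A).injective
  rw [TensorProduct.comm_lTensor]
  refine Eq.trans ?_ (h.trans ?_)
  · simp [Multiplier.left, Multiplier.flip, Multiplier.mk']
  · rw [T₃_apply]; simp [opp]

theorem mulRight_T₃ (a p b : A) :
    (LinearMap.mulRight ℂ b).lTensor A (H.T₃ (a ⊗ₜ p)) =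
      (LinearMap.mulRight ℂ p).rTensor A (H.T₁ (a ⊗ₜ b)) := by
  rw [← Δ_left_tmul', H.Δ_left_tmul]

/-- `(p ⊗ a)Δ(b) = (p ⊗ 1)((1 ⊗ a)Δ(b))`. -/
theorem Δ_right_tmul' (p a b : A) :
    (H.Δ b).right (p ⊗ₜ a) = (LinearMap.mulLeft ℂ p).rTensor A (H.T₄ (a ⊗ₜ b)) := by
  have h := H.cop.Δ_right_tmul a p b
  rw [H.cop_Δ] at h
  apply (TensorProduct.comm ℂ A A).injective
  rw [TensorProduct.comm_rTensor]
  refine Eq.trans ?_ (h.trans ?_)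
  · simp [Multiplier.right, Multiplier.flip, Multiplier.mk']
  · rw [T₄_apply]; simp [opp]

theorem mulLeft_T₄ (p a b : A) :
    (LinearMap.mulLeft ℂ p).rTensor A (H.T₄ (a ⊗ₜ b)) =
      (LinearMap.mulLeft ℂ a).lTensor A (H.T₂ (p ⊗ₜ b)) := by
  rw [← Δ_right_tmul', H.Δ_right_tmul]

/-- `(d ⊗ 1)(Δ(a)(b ⊗ 1)) = ((d ⊗ 1)Δ(a))(b ⊗ 1)`. -/
theorem mulLeft_T₃ (a b d : A) :
    (LinearMap.mulLeft ℂ d).rTensor A (H.T₃ (a ⊗ₜ b)) =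
      (LinearMap.mulRight ℂ b).rTensor A (H.T₂ (d ⊗ₜ a)) := by
  refine H.nondegenerate.eq_of_mulRight_lTensor fun c => ?_
  rw [TensorProduct.lTensor_rTensor, mulRight_T₃, TensorProduct.lTensor_rTensor, ← H.mulLeft_T₁,
    ← LinearMap.rTensor_comp_apply, ← LinearMap.rTensor_comp_apply]
  congr 2
  ext x
  simp [mul_assoc]

theorem isCounit_counit : H.IsCounit H.counit := by
  obtain ⟨ε, h1, h2⟩ := H.exists_counit
  refine Classical.epsilon_spec (p := H.IsCounit) ⟨ε, fun a b => ⟨?_, ?_⟩⟩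
  · have key : ∀ t, sliceLeft ε t = LinearMap.mul' ℂ A (H.T₁.symm t) := by
      intro t
      induction t with
      | zero => simp
      | add x y hx hy => simp only [map_add, hx, hy]
      | tmul x y => rw [h1, sliceLeft_tmul]
    simp [key]
  · have key : ∀ t, sliceRight ε t = LinearMap.mul' ℂ A (H.T₂.symm t) := by
      intro t
      induction t with
      | zero => simp
      | add x y hx hy => simp only [map_add, hx, hy]
      | tmul x y => rw [h2, sliceRight_tmul]
    simp [key]

theorem sliceLeft_counit_T₁ (t : A ⊗[ℂ] A) :
    sliceLeft H.counit (H.T₁ t) = LinearMap.mul' ℂ A t := by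
  induction t with
  | zero => simp
  | add x y hx hy => simp only [map_add, hx, hy]
  | tmul x y => rw [(H.isCounit_counit x y).1]; simp

theorem sliceRight_counit_T₂ (t : A ⊗[ℂ] A) :
    sliceRight H.counit (H.T₂ t) = LinearMap.mul' ℂ A t := by
  induction t with
  | zero => simp
  | add x y hx hy => simp only [map_add, hx, hy]
  | tmul x y => rw [(H.isCounit_counit x y).2]; simp

theorem mul_T₁_symm (t : A ⊗[ℂ] A) :
    LinearMap.mul' ℂ A (H.T₁.symm t) = sliceLeft H.counit t := by
  rw [← sliceLeft_counit_T₁, LinearEquiv.apply_symm_apply]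

/-- T₁ is onto, so the hypothesis fixes ε(a)c for every a and one nonzero c. -/
theorem counit_unique {ε : A →ₗ[ℂ] ℂ} (h : ∀ t, sliceLeft ε (H.T₁ t) = LinearMap.mul' ℂ A t) :
    ε = H.counit := by
  rcases subsingleton_or_nontrivial A with hA | hA
  · ext x
    rw [Subsingleton.elim x 0, map_zero, map_zero]
  obtain ⟨c, hc⟩ := exists_ne (0 : A)
  ext a
  obtain ⟨t, ht⟩ := H.T₁.surjective (a ⊗ₜ c)
  have h1 := h t
  rw [← sliceLeft_counit_T₁, ht, sliceLeft_tmul, sliceLeft_tmul] at h1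
  exact smul_left_injective ℂ hc h1

theorem exists_counit_eq_one [Nontrivial A] : ∃ a, H.counit a = 1 := by
  by_contra! h
  have h0 : H.counit = 0 := by
    ext a
    by_contra ha
    exact h ((H.counit a)⁻¹ • a) (by simp [inv_mul_cancel₀ ha])
  obtain ⟨c, hc⟩ := exists_ne (0 : A)
  refine hc (H.nondegenerate.1 c fun b => ?_)
  rw [← (H.isCounit_counit c b).1, h0]
  simp [sliceLeft]

/-- Multiplicativity of ε in covered form. With a ⊗ c = T₁(s), one has Δ(b)(a ⊗ c) = T₁((b ⊗ 1)s),
and ε ⊗ ι sends T₁ to the product. -/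
theorem sliceLeft_counit_mulRight (a : A) (t : A ⊗[ℂ] A) :
    sliceLeft H.counit ((LinearMap.mulRight ℂ a).rTensor A t) =
      H.counit a • sliceLeft H.counit t := by
  obtain ⟨t, rfl⟩ := H.T₁.surjective t
  induction t with
  | zero => simp
  | add x y hx hy => simp only [map_add, hx, hy, smul_add]
  | tmul b c =>
    obtain ⟨s, hs⟩ := H.T₁.surjective (a ⊗ₜ c)
    rw [← H.Δ_left_tmul, ← hs, ← H.T₁_rTensor_mulLeft, sliceLeft_counit_T₁, sliceLeft_counit_T₁]
    have key : ∀ s : A ⊗[ℂ] A, LinearMap.mul' ℂ A ((LinearMap.mulLeft ℂ b).rTensor A s) =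
        b * LinearMap.mul' ℂ A s := by
      intro s
      induction s with
      | zero => simp
      | add x y hx hy => simp only [map_add, hx, hy, mul_add]
      | tmul x y => simp [mul_assoc]
    rw [key, ← sliceLeft_counit_T₁, hs, sliceLeft_tmul, mul_smul_comm]
    simp

theorem counit_mul (a b : A) : H.counit (a * b) = H.counit a * H.counit b := by
  rcases subsingleton_or_nontrivial A with hA | hA
  · rw [Subsingleton.elim a 0]; simp
  obtain ⟨c, hc⟩ := exists_ne (0 : A)
  have h := H.sliceLeft_counit_mulRight b (a ⊗ₜ c)
  rw [LinearMap.rTensor_tmul, sliceLeft_tmul, sliceLeft_tmul, smul_smul, mul_comm] at h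
  simpa [mul_comm] using smul_left_injective ℂ hc h

/-- The claim is (ι ⊗ ε)(Δ(a)(b ⊗ 1)) = ab. Multiplying by d from the left replaces T₃ by T₂, where
the counit property is known. -/
theorem opp_counit : H.opp.counit = H.counit := by
  refine (H.opp.counit_unique fun t => ?_).symm
  induction t with
  | zero => simp
  | add x y hx hy => simp only [map_add, hx, hy]
  | tmul a b =>
    have h1 : ∀ t, sliceLeft H.counit t = sliceRight H.counit (TensorProduct.comm ℂ A A t) := by
      intro t
      induction t with
      | zero => simp
      | add x y hx hy => simp only [map_add, hx, hy]
      | tmul x y => simp [sliceLeft, sliceRight]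
    rw [h1, ← T₃_apply, ← sub_eq_zero]
    refine H.nondegenerate.2 _ fun d => ?_
    have h2 : ∀ t, d * sliceRight H.counit t =
        sliceRight H.counit ((LinearMap.mulLeft ℂ d).rTensor A t) := by
      intro t
      induction t with
      | zero => simp
      | add x y hx hy => simp only [map_add, hx, hy, mul_add]
      | tmul x y => simp [sliceRight, mul_smul_comm]
    have h3 : ∀ t, sliceRight H.counit t * b =
        sliceRight H.counit ((LinearMap.mulRight ℂ b).rTensor A t) := by
      intro t
      induction t with
      | zero => simp
      | add x y hx hy => simp only [map_add, hx, hy, add_mul]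
      | tmul x y => simp [sliceRight, smul_mul_assoc]
    rw [mul_sub, h2, mulLeft_T₃, ← h3, sliceRight_counit_T₂]
    simp [mul_assoc]

/-- The map `a ⊗ b ↦ S(a) b`. -/
def antipodeMul : A ⊗[ℂ] A →ₗ[ℂ] A := sliceLeft H.counit ∘ₗ H.T₁.symm.toLinearMap

theorem antipodeMul_T₁ (t : A ⊗[ℂ] A) : H.antipodeMul (H.T₁ t) = sliceLeft H.counit t := by
  simp [antipodeMul]

theorem antipodeMul_mulRight_lTensor (c : A) (t : A ⊗[ℂ] A) :
    H.antipodeMul ((LinearMap.mulRight ℂ c).lTensor A t) = H.antipodeMul t * c := by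
  obtain ⟨t, rfl⟩ := H.T₁.surjective t
  rw [← H.T₁_lTensor_mulRight, antipodeMul_T₁, antipodeMul_T₁]
  induction t with
  | zero => simp
  | add x y hx hy => simp only [map_add, hx, hy, add_mul]
  | tmul x y => simp [sliceLeft, smul_mul_assoc]

/-- In Sweedler notation, ∑ S(a₁b)a₂c = ε(a)S(b)c; this is multiplicativity of ε seen through T₁⁻¹.
It makes S antimultiplicative and places S(b) in A. -/
theorem antipodeMul_mulRight_T₁ (a b c : A) :
    H.antipodeMul ((LinearMap.mulRight ℂ b).rTensor A (H.T₁ (a ⊗ₜ c))) =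
      H.counit a • H.antipodeMul (b ⊗ₜ c) := by
  obtain ⟨s, hs⟩ := H.T₁.surjective (b ⊗ₜ c)
  rw [← H.Δ_left_tmul, ← hs, ← H.T₁_rTensor_mulLeft, antipodeMul_T₁, antipodeMul_T₁]
  clear hs
  induction s with
  | zero => simp
  | add x y hx hy => simp only [map_add, hx, hy, smul_add]
  | tmul x y => simp [sliceLeft, counit_mul, mul_smul]

theorem antipodeMul_mulRight_rTensor (b : A) (t : A ⊗[ℂ] A) :
    H.antipodeMul ((LinearMap.mulRight ℂ b).rTensor A t) =
      H.antipodeMul (b ⊗ₜ H.antipodeMul t) := by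
  obtain ⟨t, rfl⟩ := H.T₁.surjective t
  induction t with
  | zero => simp
  | add x y hx hy => simp only [map_add, hx, hy, TensorProduct.tmul_add]
  | tmul a c => rw [antipodeMul_mulRight_T₁, antipodeMul_T₁, sliceLeft_tmul,
      TensorProduct.tmul_smul, map_smul]

/-- `(a ⊗ 1) T₁⁻¹(b ⊗ c) = (ι ⊗ S)((a ⊗ 1)Δ(b)) (1 ⊗ c)`. -/
theorem mulLeft_T₁_symm (a b c : A) :
    (LinearMap.mulLeft ℂ a).rTensor A (H.T₁.symm (b ⊗ₜ c)) =
      H.antipodeMul.lTensor A (TensorProduct.assoc ℂ A A A (H.T₂ (a ⊗ₜ b) ⊗ₜ c)) := by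
  -- After slicing by ε, T₁⁻¹ becomes a ⊗ b ↦ S(a)b on one side and T₂ becomes the product on the
  -- other.
  have h := congrArg ((sliceLeft H.counit).lTensor A) (H.T₁_symm_coassoc a (b ⊗ₜ c))
  rw [← LinearMap.lTensor_comp_apply, LinearMap.rTensor_tmul] at h
  refine Eq.trans ?_ h.symm
  induction H.T₁.symm (b ⊗ₜ c) with
  | zero => simp
  | add x y hx hy => simp only [map_add, hx, hy]
  | tmul x y =>
    have key : ∀ u : A ⊗[ℂ] A, (sliceLeft H.counit).lTensor A
        (TensorProduct.assoc ℂ A A A (u ⊗ₜ y)) = sliceRight H.counit u ⊗ₜ y := by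
      intro u
      induction u with
      | zero => simp
      | add x y hx hy => simp only [map_add, hx, hy, TensorProduct.add_tmul]
      | tmul p q => simp [sliceLeft, sliceRight, TensorProduct.smul_tmul]
    simp only [LinearMap.rTensor_tmul, LinearMap.comp_apply, TensorProduct.mk_apply,
      LinearEquiv.coe_coe]
    rw [key, sliceRight_counit_T₂]
    simp

/-- Without regularity, S(b) would only be a multiplier. Choosing ε(a) = 1 gives S(b) = ∑ S(a₁b)a₂,
which lies in A because Δ(a)(b ⊗ 1) lies in A ⊗ A. -/
theorem exists_antipodeMul_eq : ∃ S : A →ₗ[ℂ] A, ∀ b c, S b * c = H.antipodeMul (b ⊗ₜ c) := by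
  rcases subsingleton_or_nontrivial A with hA | hA
  · exact ⟨0, fun b c => Subsingleton.elim _ _⟩
  obtain ⟨a, ha⟩ := H.exists_counit_eq_one
  refine ⟨H.antipodeMul ∘ₗ H.T₃.toLinearMap ∘ₗ TensorProduct.mk ℂ A A a, fun b c => ?_⟩
  simp only [LinearMap.comp_apply, TensorProduct.mk_apply, LinearEquiv.coe_coe]
  rw [← antipodeMul_mulRight_lTensor, mulRight_T₃, antipodeMul_mulRight_T₁, ha, one_smul]

section

variable {H} {S : A →ₗ[ℂ] A} (hS : ∀ b c, S b * c = H.antipodeMul (b ⊗ₜ c))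
include hS

theorem antipode_mul_aux (a b : A) : S (a * b) = S b * S a := by
  rw [← sub_eq_zero]
  refine H.nondegenerate.1 _ fun c => ?_
  have h := H.antipodeMul_mulRight_rTensor b (a ⊗ₜ c)
  rw [LinearMap.rTensor_tmul, LinearMap.mulRight_apply, ← hS, ← hS, ← hS] at h
  rw [sub_mul, h, mul_assoc, sub_self]

theorem mul_antipode_T₁_aux (t : A ⊗[ℂ] A) :
    LinearMap.mul' ℂ A (S.rTensor A (H.T₁ t)) = sliceLeft H.counit t := by
  rw [← antipodeMul_T₁]
  induction H.T₁ t with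
  | zero => simp
  | add x y hx hy => simp only [map_add, hx, hy]
  | tmul x y => simp [hS]

theorem mul_antipode_T₂_aux (a b : A) :
    LinearMap.mul' ℂ A (S.lTensor A (H.T₂ (a ⊗ₜ b))) = H.counit b • a := by
  rw [← sub_eq_zero]
  refine H.nondegenerate.1 _ fun c => ?_
  have h := congrArg (LinearMap.mul' ℂ A) (H.mulLeft_T₁_symm a b c)
  have key : ∀ s : A ⊗[ℂ] A, LinearMap.mul' ℂ A ((LinearMap.mulLeft ℂ a).rTensor A s) =
        a * LinearMap.mul' ℂ A s := by
    intro s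
    induction s with
    | zero => simp
    | add x y hx hy => simp only [map_add, hx, hy, mul_add]
    | tmul x y => simp [mul_assoc]
  have key' : ∀ s : A ⊗[ℂ] A, LinearMap.mul' ℂ A (H.antipodeMul.lTensor A
      (TensorProduct.assoc ℂ A A A (s ⊗ₜ c))) = LinearMap.mul' ℂ A (S.lTensor A s) * c := by
    intro s
    induction s with
    | zero => simp
    | add x y hx hy => simp only [map_add, hx, hy, add_mul, TensorProduct.add_tmul]
    | tmul x y => simp [mul_assoc, hS]
  rw [key, key', mul_T₁_symm, sliceLeft_tmul] at h
  rw [sub_mul, ← h, mul_smul_comm, smul_mul_assoc, sub_self]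

/-- Taking ε(b) = 1 in the second antipode identity shows that A is contained in A S(A), so an x
annihilated by S(A) is annihilated by A. -/
theorem eq_zero_of_antipode_mul_aux {x : A} (h : ∀ q, S q * x = 0) : x = 0 := by
  rcases subsingleton_or_nontrivial A with hA | hA
  · exact Subsingleton.elim _ _
  obtain ⟨b, hb⟩ := H.exists_counit_eq_one
  refine H.nondegenerate.2 _ fun a => ?_
  have h1 := mul_antipode_T₂_aux hS a b
  rw [hb, one_smul] at h1
  rw [← h1]
  induction H.T₂ (a ⊗ₜ b) with
  | zero => simp
  | add x y hx hy => simp only [map_add, hx, hy, add_mul, add_zero]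
  | tmul x y => simp [mul_assoc, h]

theorem antipode_T₃_aux (a b : A) :
    LinearMap.mul' ℂ A (S.rTensor A (H.T₃ (a ⊗ₜ b))) = H.counit a • S b := by
  rw [← sub_eq_zero]
  refine H.nondegenerate.1 _ fun c => ?_
  have h := H.antipodeMul_mulRight_T₁ a b c
  rw [← mulRight_T₃, antipodeMul_mulRight_lTensor, ← hS] at h
  have key : ∀ s : A ⊗[ℂ] A, LinearMap.mul' ℂ A (S.rTensor A s) = H.antipodeMul s := by
    intro s
    induction s with
    | zero => simp
    | add x y hx hy => simp only [map_add, hx, hy]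
    | tmul x y => simp [hS]
  rw [sub_mul, key, h, smul_mul_assoc, sub_self]

/-- Applying S to ∑ S'(x₂)x₁y = ε(x)y gives ∑ S(x₁y)S(S'(x₂)) = ε(x)S(y) = ∑ S(x₁y)x₂. Since T₃ is
onto, S(p)S(S'(q)) = S(p)q for all p and q, and S(p) can be cancelled. Exchanging the roles of Δ and
its opposite makes S bijective. -/
theorem antipode_opp_aux {S' : A →ₗ[ℂ] A} (hS' : ∀ b c, S' b * c = H.opp.antipodeMul (b ⊗ₜ c))
    (b : A) : S (S' b) = b := by
  have key : ∀ u : A ⊗[ℂ] A, LinearMap.mul' ℂ A (TensorProduct.map S (S ∘ₗ S') u) =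
      LinearMap.mul' ℂ A (S.rTensor A u) := by
    intro u
    obtain ⟨u, rfl⟩ := H.T₃.surjective u
    induction u with
    | zero => simp
    | add x y hx hy => simp only [map_add, hx, hy]
    | tmul x y =>
      rw [antipode_T₃_aux hS]
      have h := congrArg S (mul_antipode_T₁_aux hS' (x ⊗ₜ y))
      rw [opp_counit, sliceLeft_tmul, map_smul] at h
      rw [← h, T₃_apply]
      induction H.opp.T₁ (x ⊗ₜ y) with
      | zero => simp
      | add x y hx hy => simp only [map_add, hx, hy]
      | tmul x y => simp [antipode_mul_aux hS]
  rw [← sub_eq_zero]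
  refine eq_zero_of_antipode_mul_aux hS fun q => ?_
  have := key (q ⊗ₜ b)
  simp only [TensorProduct.map_tmul, LinearMap.mul'_apply, LinearMap.comp_apply,
    LinearMap.rTensor_tmul] at this
  rw [mul_sub, this, sub_self]

end

theorem isAntipode_antipode : H.IsAntipode H.antipode := by
  obtain ⟨S, hS⟩ := H.exists_antipodeMul_eq
  obtain ⟨S', hS'⟩ := H.opp.exists_antipodeMul_eq
  let e : A ≃ₗ[ℂ] A := LinearEquiv.ofLinearMap S S' (LinearMap.ext (antipode_opp_aux hS hS'))
    (LinearMap.ext (antipode_opp_aux hS' hS))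
  refine Classical.epsilon_spec (p := H.IsAntipode) ⟨e, fun a b => ⟨?_, ?_⟩⟩
  · have h := mul_antipode_T₁_aux hS (a ⊗ₜ b)
    rw [sliceLeft_tmul] at h
    rw [← h]
    induction H.T₁ (a ⊗ₜ b) with
    | zero => simp
    | add x y hx hy => simp only [map_add, hx, hy]
    | tmul x y => simp [e]
  · rw [← mul_antipode_T₂_aux hS a b]
    induction H.T₂ (a ⊗ₜ b) with
    | zero => simp
    | add x y hx hy => simp only [map_add, hx, hy]
    | tmul x y => simp [e]

/-- Uniqueness of the antipode: its first identity determines it because T₁ is onto. -/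
theorem antipode_mul_eq (b c : A) : H.antipode b * c = H.antipodeMul (b ⊗ₜ c) := by
  obtain ⟨t, ht⟩ := H.T₁.surjective (b ⊗ₜ c)
  have key : ∀ t, TensorProduct.lift ((LinearMap.mul ℂ A).comp H.antipode.toLinearMap) (H.T₁ t) =
      sliceLeft H.counit t := by
    intro t
    induction t with
    | zero => simp
    | add x y hx hy => simp only [map_add, hx, hy]
    | tmul x y => rw [(H.isAntipode_antipode x y).1, sliceLeft_tmul]
  have h := key t
  rw [← antipodeMul_T₁, ht] at h
  simpa using h

theorem antipode_mul (a b : A) : H.antipode (a * b) = H.antipode b * H.antipode a :=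
  antipode_mul_aux (S := H.antipode.toLinearMap) H.antipode_mul_eq a b

theorem opp_antipode : H.opp.antipode = H.antipode.symm := by
  ext b
  rw [LinearEquiv.eq_symm_apply]
  exact antipode_opp_aux (S := H.antipode.toLinearMap) H.antipode_mul_eq
    (S' := H.opp.antipode.toLinearMap) H.opp.antipode_mul_eq b

/-- `(a ⊗ 1) T₁⁻¹(b ⊗ c) = (ι ⊗ S)((a ⊗ 1)Δ(b)) (1 ⊗ c)`. -/
theorem mulLeft_T₁_symm_eq (a b c : A) :
    (LinearMap.mulLeft ℂ a).rTensor A (H.T₁.symm (b ⊗ₜ c)) =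
      (LinearMap.mulRight ℂ c).lTensor A (H.antipode.toLinearMap.lTensor A (H.T₂ (a ⊗ₜ b))) := by
  rw [mulLeft_T₁_symm]
  induction H.T₂ (a ⊗ₜ b) with
  | zero => simp
  | add x y hx hy => simp only [map_add, hx, hy, TensorProduct.add_tmul]
  | tmul x y => simp [antipode_mul_eq]

/-- `T₁⁻¹(b ⊗ S(c)) = (ι ⊗ S)((1 ⊗ c)Δ(b))`. -/
theorem T₁_symm_antipode (b c : A) :
    H.T₁.symm (b ⊗ₜ H.antipode c) = H.antipode.toLinearMap.lTensor A (H.T₄ (c ⊗ₜ b)) := by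
  refine H.nondegenerate.eq_of_mulLeft_rTensor fun a => ?_
  rw [mulLeft_T₁_symm_eq, ← TensorProduct.lTensor_rTensor,
    mulLeft_T₄, ← LinearMap.lTensor_comp_apply, ← LinearMap.lTensor_comp_apply]
  congr 2
  ext x
  simp [antipode_mul]

end RegularMultiplierHopfAlgebra

theorem sliceRight_mul {A : Type u} [NonUnitalRing A] [Module ℂ A] [IsScalarTower ℂ A A]
    (ω : A →ₗ[ℂ] ℂ) (t : A ⊗[ℂ] A) (d : A) :
    sliceRight ω t * d = sliceRight ω ((LinearMap.mulRight ℂ d).rTensor A t) := by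
  induction t with
  | zero => simp
  | add x y hx hy => simp only [map_add, hx, hy, add_mul]
  | tmul x y => simp [sliceRight, smul_mul_assoc]

theorem mul_sliceRight {A : Type u} [NonUnitalRing A] [Module ℂ A] [SMulCommClass ℂ A A]
    (ω : A →ₗ[ℂ] ℂ) (t : A ⊗[ℂ] A) (d : A) :
    d * sliceRight ω t = sliceRight ω ((LinearMap.mulLeft ℂ d).rTensor A t) := by
  induction t with
  | zero => simp
  | add x y hx hy => simp only [map_add, hx, hy, mul_add]
  | tmul x y => simp [sliceRight, mul_smul_comm]

theorem sliceRight_lTensor {A : Type u} [AddCommGroup A] [Module ℂ A]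
    (ω : A →ₗ[ℂ] ℂ) (f : A →ₗ[ℂ] A) (t : A ⊗[ℂ] A) :
    sliceRight ω (f.lTensor A t) = sliceRight (ω ∘ₗ f) t := by
  simp [sliceRight, LinearMap.lTensor_comp]

namespace RegularMultiplierHopfAlgebra

variable {A : Type u} [NonUnitalRing A] [Module ℂ A] [IsScalarTower ℂ A A] [SMulCommClass ℂ A A]
  (H : RegularMultiplierHopfAlgebra A)

theorem T₄_lTensor_mulRight (a : A) (t : A ⊗[ℂ] A) :
    H.T₄ ((LinearMap.mulRight ℂ a).lTensor A t) = (H.Δ a).right (H.T₄ t) := by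
  have h := H.cop.T₂_lTensor_mulRight a t
  rw [H.cop_Δ] at h
  rw [T₄_apply, T₄_apply]
  refine (congrArg (TensorProduct.comm ℂ A A) h).trans ?_
  simp [Multiplier.right, Multiplier.flip, Multiplier.mk', opp]

end RegularMultiplierHopfAlgebra

/-! ### Dual pairs: unitality of B ▷ A, and the commutant of B ▷ and right multiplications. -/

namespace DualPair

open RegularMultiplierHopfAlgebra

variable {A : Type u} [NonUnitalRing A] [Module ℂ A] [IsScalarTower ℂ A A] [SMulCommClass ℂ A A]
  {B : Type w} [NonUnitalRing B] [Module ℂ B] [IsScalarTower ℂ B B] [SMulCommClass ℂ B B]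
  {HA : RegularMultiplierHopfAlgebra A} {HB : RegularMultiplierHopfAlgebra B}

/-- The dual pair `(B, A)`. -/
def swap (P : DualPair HA HB) : DualPair HB HA where
  form := P.form.flip
  nondegenerate_left := P.nondegenerate_right
  nondegenerate_right := P.nondegenerate_left
  leftA := P.leftB
  leftA_spec := P.leftB_spec
  rightA := P.rightB
  rightA_spec := P.rightB_spec
  leftB := P.leftA
  leftB_spec := P.leftA_spec
  rightB := P.rightA
  rightB_spec := P.rightA_spec
  form_leftA b b' a := P.form_leftB a b b'
  form_rightA b b' a := P.form_rightB a b b'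
  form_leftB b a a' := P.form_leftA a a' b
  form_rightB b a a' := P.form_rightA a a' b
  unital := by
    rcases P.unital with h | h | h | h
    · exact Or.inr (Or.inr (Or.inl h))
    · exact Or.inr (Or.inr (Or.inr h))
    · exact Or.inl h
    · exact Or.inr (Or.inl h)

variable (P : DualPair HA HB)

theorem leftB_leftB (b b' : B) (a : A) : P.leftB b' (P.leftB b a) = P.leftB (b' * b) a := by
  rw [← sub_eq_zero]
  refine P.nondegenerate_left _ fun c => ?_
  rw [map_sub, LinearMap.sub_apply, P.form_leftB, P.form_leftB, P.form_leftB, mul_assoc, sub_self]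

/-- `Δ(b ▷ a)(c ⊗ 1) = (ι ⊗ b ▷)(Δ(a)(c ⊗ 1))`. -/
theorem T₃_leftB (b : B) (a c : A) :
    HA.T₃ (P.leftB b a ⊗ₜ c) = (P.leftB b).lTensor A (HA.T₃ (a ⊗ₜ c)) := by
  refine TensorProduct.eq_of_lTensor (fun b : B => P.form.flip b)
    (fun x hx => P.nondegenerate_left x hx) fun b' => ?_
  apply (TensorProduct.rid ℂ A).injective
  change sliceRight (P.form.flip b') _ = sliceRight (P.form.flip b') _
  have h : P.form.flip b' ∘ₗ P.leftB b = P.form.flip (b' * b) := by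
    ext x
    simp [P.form_leftB]
  rw [sliceRight_lTensor, h, ← (P.leftB_spec b' _ c).1, ← (P.leftB_spec (b' * b) a c).1,
    leftB_leftB]

theorem flip_comp_mulRight (q : A) (b : B) :
    P.form.flip b ∘ₗ LinearMap.mulRight ℂ q = P.form.flip (P.leftA q b) := by
  ext x
  simp [P.form_leftA]

theorem flip_comp_mulLeft (q : A) (b : B) :
    P.form.flip b ∘ₗ LinearMap.mulLeft ℂ q = P.form.flip (P.rightA q b) := by
  ext x
  simp [P.form_rightA]

theorem sliceRight_T₁ (b : B) (a q : A) :
    sliceRight (P.form.flip b) (HA.T₁ (a ⊗ₜ q)) = P.leftB (P.leftA q b) a := by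
  rw [← sub_eq_zero]
  refine HA.nondegenerate.1 _ fun d => ?_
  rw [sub_mul, sliceRight_mul, ← mulRight_T₃, sliceRight_lTensor, flip_comp_mulRight,
    (P.leftB_spec _ a d).1, sub_self]

theorem sliceRight_T₄ (b : B) (a q : A) :
    sliceRight (P.form.flip b) (HA.T₄ (q ⊗ₜ a)) = P.leftB (P.rightA q b) a := by
  rw [← sub_eq_zero]
  refine HA.nondegenerate.2 _ fun d => ?_
  rw [mul_sub, mul_sliceRight, mulLeft_T₄, sliceRight_lTensor, flip_comp_mulLeft,
    (P.leftB_spec _ a d).2, sub_self]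

/-- Any nonzero x is a scalar multiple of a slice of x ⊗ x, so the slices of A ⊗ A span A. -/
theorem span_leftB_of_slice
    (h : ∀ (b : B) (t : A ⊗[ℂ] A), sliceRight (P.form.flip b) t ∈
      Submodule.span ℂ {y : A | ∃ (b : B) (a : A), P.leftB b a = y}) :
    Submodule.span ℂ {y : A | ∃ (b : B) (a : A), P.leftB b a = y} = ⊤ := by
  rw [eq_top_iff]
  intro x _
  by_cases hx : x = 0
  · rw [hx]; exact Submodule.zero_mem _
  obtain ⟨b, hb⟩ : ∃ b, P.form x b ≠ 0 := by
    by_contra! h0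
    exact hx (P.nondegenerate_left x h0)
  have h1 := Submodule.smul_mem _ (P.form x b)⁻¹ (h b (x ⊗ₜ x))
  rw [sliceRight_tmul, LinearMap.flip_apply, smul_smul, inv_mul_cancel₀ hb, one_smul] at h1
  exact h1

theorem span_leftB_of_leftA
    (h : Submodule.span ℂ {y : B | ∃ (a : A) (b : B), P.leftA a b = y} = ⊤) :
    Submodule.span ℂ {y : A | ∃ (b : B) (a : A), P.leftB b a = y} = ⊤ := by
  refine P.span_leftB_of_slice fun b t => ?_
  have hb : b ∈ Submodule.span ℂ {y : B | ∃ (a : A) (b : B), P.leftA a b = y} := by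
    rw [h]; trivial
  obtain ⟨t, rfl⟩ := HA.T₃.surjective t
  induction t with
  | zero => simp
  | add x y hx hy => simpa only [map_add] using Submodule.add_mem _ hx hy
  | tmul a d =>
    induction hb using Submodule.span_induction with
    | zero => simp [sliceRight]
    | add x y _ _ hx hy =>
      have : sliceRight (P.form.flip (x + y)) (HA.T₃ (a ⊗ₜ d)) =
          sliceRight (P.form.flip x) (HA.T₃ (a ⊗ₜ d)) +
          sliceRight (P.form.flip y) (HA.T₃ (a ⊗ₜ d)) := by
        simp [sliceRight, LinearMap.lTensor_add]
      rw [this]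
      exact Submodule.add_mem _ hx hy
    | smul c x _ hx =>
      have : sliceRight (P.form.flip (c • x)) (HA.T₃ (a ⊗ₜ d)) =
          c • sliceRight (P.form.flip x) (HA.T₃ (a ⊗ₜ d)) := by
        simp [sliceRight, LinearMap.lTensor_smul]
      rw [this]
      exact Submodule.smul_mem _ c hx
    | mem x hx =>
      obtain ⟨e, b', rfl⟩ := hx
      -- With the functional given by e ▷ b', the factor e moves into the second leg, producing
      -- Δ(a)(d ⊗ e) = Δ(a)T₁(s) = T₁((a ⊗ 1)s). Slices of T₁ lie in B ▷ A by `sliceRight_T₁`.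
      obtain ⟨s, hs⟩ := HA.T₁.surjective (d ⊗ₜ e)
      rw [← flip_comp_mulRight, ← sliceRight_lTensor, ← HA.Δ_left_tmul', ← hs,
        ← HA.T₁_rTensor_mulLeft]
      induction (LinearMap.mulLeft ℂ a).rTensor A s with
      | zero => simp
      | add x y hx hy => simpa only [map_add] using Submodule.add_mem _ hx hy
      | tmul p q =>
        rw [sliceRight_T₁]
        exact Submodule.subset_span ⟨_, _, rfl⟩

theorem span_leftB_of_rightA
    (h : Submodule.span ℂ {y : B | ∃ (a : A) (b : B), P.rightA a b = y} = ⊤) :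
    Submodule.span ℂ {y : A | ∃ (b : B) (a : A), P.leftB b a = y} = ⊤ := by
  refine P.span_leftB_of_slice fun b t => ?_
  have hb : b ∈ Submodule.span ℂ {y : B | ∃ (a : A) (b : B), P.rightA a b = y} := by
    rw [h]; trivial
  obtain ⟨t, rfl⟩ := HA.T₂.surjective t
  induction t with
  | zero => simp
  | add x y hx hy => simpa only [map_add] using Submodule.add_mem _ hx hy
  | tmul d a =>
    induction hb using Submodule.span_induction with
    | zero => simp [sliceRight]
    | add x y _ _ hx hy =>
      have : sliceRight (P.form.flip (x + y)) (HA.T₂ (d ⊗ₜ a)) =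
          sliceRight (P.form.flip x) (HA.T₂ (d ⊗ₜ a)) +
          sliceRight (P.form.flip y) (HA.T₂ (d ⊗ₜ a)) := by
        simp [sliceRight, LinearMap.lTensor_add]
      rw [this]
      exact Submodule.add_mem _ hx hy
    | smul c x _ hx =>
      have : sliceRight (P.form.flip (c • x)) (HA.T₂ (d ⊗ₜ a)) =
          c • sliceRight (P.form.flip x) (HA.T₂ (d ⊗ₜ a)) := by
        simp [sliceRight, LinearMap.lTensor_smul]
      rw [this]
      exact Submodule.smul_mem _ c hx
    | mem x hx =>
      obtain ⟨e, b', rfl⟩ := hx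
      -- The mirror image: (d ⊗ e)Δ(a) = T₄(s)Δ(a) is again in the form of T₄.
      obtain ⟨s, hs⟩ := HA.T₄.surjective (d ⊗ₜ e)
      rw [← flip_comp_mulLeft, ← sliceRight_lTensor, ← HA.Δ_right_tmul, ← hs,
        ← HA.T₄_lTensor_mulRight]
      induction (LinearMap.mulRight ℂ a).lTensor A s with
      | zero => simp
      | add x y hx hy => simpa only [map_add] using Submodule.add_mem _ hx hy
      | tmul q p =>
        rw [sliceRight_T₄]
        exact Submodule.subset_span ⟨_, _, rfl⟩

/-- If one of the four modules of a dual pair is unital, then `B ▷ A = A`. -/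
theorem span_leftB : Submodule.span ℂ {y : A | ∃ (b : B) (a : A), P.leftB b a = y} = ⊤ := by
  rcases P.unital with h | h | h | h
  · exact P.span_leftB_of_leftA h
  · exact P.span_leftB_of_rightA h
  · exact h
  -- In the swapped pair, unitality of A ◁ B gives A ▷ B = B, and this gives B ▷ A = A.
  · exact P.span_leftB_of_leftA (P.swap.span_leftB_of_rightA h)

/-- A linear map of `A` commuting with right multiplications and with `B ▷` is a scalar. -/
theorem exists_eq_smul_of_commute (f : A →ₗ[ℂ] A) (hf : ∀ a a', f (a * a') = f a * a')
    (hB : ∀ b a, f (P.leftB b a) = P.leftB b (f a)) : ∃ c : ℂ, ∀ a, f a = c • a := by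
  rcases subsingleton_or_nontrivial A with hA | hA
  · exact ⟨0, fun a => Subsingleton.elim _ _⟩
  -- This is Δ(f(a)) = (f ⊗ ι)Δ(a), tested on the slices b ▷: both commutation hypotheses enter
  -- here.
  have h3 : ∀ a d, HA.T₃ (f a ⊗ₜ d) = f.rTensor A (HA.T₃ (a ⊗ₜ d)) := by
    intro a d
    refine TensorProduct.eq_of_lTensor (fun b : B => P.form.flip b)
      (fun x hx => P.nondegenerate_left x hx) fun b => ?_
    apply (TensorProduct.rid ℂ A).injective
    change sliceRight (P.form.flip b) _ = sliceRight (P.form.flip b) _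
    have key : ∀ t : A ⊗[ℂ] A, sliceRight (P.form.flip b) (f.rTensor A t) =
        f (sliceRight (P.form.flip b) t) := by
      intro t
      induction t with
      | zero => simp
      | add x y hx hy => simp only [map_add, hx, hy]
      | tmul x y => simp [sliceRight]
    rw [key, ← (P.leftB_spec b _ d).1, ← (P.leftB_spec b _ d).1, hf, hB]
  have h1 : ∀ a d, HA.T₁ (f a ⊗ₜ d) = f.rTensor A (HA.T₁ (a ⊗ₜ d)) := by
    intro a d
    refine HA.nondegenerate.eq_of_mulRight_rTensor fun c => ?_
    rw [← mulRight_T₃, h3, TensorProduct.lTensor_rTensor, mulRight_T₃,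
      ← LinearMap.rTensor_comp_apply, ← LinearMap.rTensor_comp_apply]
    congr 2
    ext x
    simp [hf]
  -- Applying ε ⊗ ι: f(a) = ∑ ε(f(a₁))a₂, so f is determined by the functional ε ∘ f. The next
  -- identity, `key`, uses that ε(f(ac)) = ε(f(a))ε(c).
  have h2 : ∀ a d, f a * d = sliceLeft HA.counit (f.rTensor A (HA.T₁ (a ⊗ₜ d))) := by
    intro a d
    rw [← h1, sliceLeft_counit_T₁]
    simp
  have key : ∀ (c : A) (t : A ⊗[ℂ] A), sliceLeft HA.counit (f.rTensor A
      ((LinearMap.mulRight ℂ c).rTensor A t)) =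
      HA.counit c • sliceLeft HA.counit (f.rTensor A t) := by
    intro c t
    rw [← sliceLeft_counit_mulRight, ← LinearMap.rTensor_comp_apply,
      ← LinearMap.rTensor_comp_apply]
    congr 3
    ext x
    simp [hf]
  have h4 : ∀ (s : A ⊗[ℂ] A) (d : A), sliceLeft HA.counit (f.rTensor A
      ((LinearMap.mulRight ℂ d).lTensor A (HA.T₃ s))) = f (sliceRight HA.counit s) * d := by
    intro s d
    induction s with
    | zero => simp
    | add x y hx hy => simp only [map_add, hx, hy, add_mul]
    | tmul a c =>
      rw [mulRight_T₃, key, ← h2]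
      simp [sliceRight, smul_mul_assoc]
  have h5 : ∀ (s : A ⊗[ℂ] A) (d : A), sliceLeft HA.counit
      ((LinearMap.mulRight ℂ d).lTensor A (HA.T₃ s)) = sliceRight HA.counit s * d := by
    intro s d
    induction s with
    | zero => simp
    | add x y hx hy => simp only [map_add, hx, hy, add_mul]
    | tmul a c =>
      rw [mulRight_T₃, sliceLeft_counit_mulRight, sliceLeft_counit_T₁]
      simp [sliceRight, smul_mul_assoc]
  -- Write e ⊗ g = Δ-form T₃(s) with ε(e) = 1. Slicing by ε shows (ι ⊗ ε)(s) = g; slicing by ε ∘ f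
  -- then shows ε(f(e))g = f(g).
  obtain ⟨e, he⟩ := HA.exists_counit_eq_one
  refine ⟨HA.counit (f e), fun g => ?_⟩
  obtain ⟨s, hs⟩ := HA.T₃.surjective (e ⊗ₜ g)
  have h6 : sliceRight HA.counit s = g := by
    rw [← sub_eq_zero]
    refine HA.nondegenerate.1 _ fun d => ?_
    rw [sub_mul, ← h5, hs]
    simp [sliceLeft, he]
  rw [← sub_eq_zero]
  refine HA.nondegenerate.1 _ fun d => ?_
  have h7 := h4 s d
  rw [h6, hs] at h7
  rw [sub_mul, ← h7]
  simp [sliceLeft, smul_mul_assoc]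

end DualPair

/-! ### Module algebras: the pentagon equation and the exchange map `cross`. -/

/-- The pentagon equation for `T₁`. -/
theorem MultiplierHopfAlgebra.pentagon {A : Type u} [NonUnitalRing A] [Module ℂ A]
    [IsScalarTower ℂ A A] [SMulCommClass ℂ A A] (H : MultiplierHopfAlgebra A)
    (a c d : A) (s : A ⊗[ℂ] A) (hs : H.T₁ s = c ⊗ₜ d) :
    TensorProduct.assoc ℂ A A A ((H.T₁.toLinearMap ∘ₗ (TensorProduct.mk ℂ A A).flip c).rTensor A
      (H.T₁ (a ⊗ₜ d))) =
    H.T₁.toLinearMap.lTensor A (TensorProduct.assoc ℂ A A A (H.T₁.toLinearMap.rTensor A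
      ((TensorProduct.assoc ℂ A A A).symm (a ⊗ₜ s)))) := by
  refine H.nondegenerate.eq_of_mulLeft_rTensor fun e => ?_
  -- Multiplying the first leg by e turns the T₁ on the first two legs into T₂, which is the form in
  -- which coassociativity is available. The remaining ingredient is Δ(q)(c ⊗ d) = Δ(q)T₁(s) = T₁((q
  -- ⊗ 1)s).
  have h1 : ∀ u : A ⊗[ℂ] A, (LinearMap.mulLeft ℂ e).rTensor (A ⊗[ℂ] A)
      (TensorProduct.assoc ℂ A A A
        ((H.T₁.toLinearMap ∘ₗ (TensorProduct.mk ℂ A A).flip c).rTensor A u)) =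
      ((LinearMap.mulRight ℂ c).rTensor A).lTensor A (TensorProduct.assoc ℂ A A A
        ((H.T₂.toLinearMap ∘ₗ TensorProduct.mk ℂ A A e).rTensor A u)) := by
    intro u
    induction u with
    | zero => simp
    | add x y hx hy => simp only [map_add, hx, hy]
    | tmul p q =>
      have h2 : ∀ v : A ⊗[ℂ] A, (LinearMap.mulLeft ℂ e).rTensor (A ⊗[ℂ] A)
          (TensorProduct.assoc ℂ A A A (v ⊗ₜ q)) =
          TensorProduct.assoc ℂ A A A ((LinearMap.mulLeft ℂ e).rTensor A v ⊗ₜ q) := by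
        intro v
        induction v with
        | zero => simp
        | add x y hx hy => simp only [map_add, hx, hy, TensorProduct.add_tmul]
        | tmul p q => simp
      simp only [LinearMap.rTensor_tmul, LinearMap.comp_apply, LinearMap.flip_apply,
        TensorProduct.mk_apply, LinearEquiv.coe_coe]
      rw [h2, H.mulLeft_T₁]
      induction H.T₂ (e ⊗ₜ p) with
      | zero => simp
      | add x y hx hy => simp only [map_add, hx, hy, TensorProduct.add_tmul]
      | tmul p q => simp
  rw [h1, H.assoc_T₂_T₁]
  have h3 : (LinearMap.mulLeft ℂ e).rTensor (A ⊗[ℂ] A) (H.T₁.toLinearMap.lTensor A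
      (TensorProduct.assoc ℂ A A A (H.T₁.toLinearMap.rTensor A
      ((TensorProduct.assoc ℂ A A A).symm (a ⊗ₜ s))))) =
      H.T₁.toLinearMap.lTensor A (((LinearMap.rTensorHom A ∘ₗ LinearMap.mul ℂ A :
        A →ₗ[ℂ] A ⊗[ℂ] A →ₗ[ℂ] A ⊗[ℂ] A).flip s).lTensor A (H.T₂ (e ⊗ₜ a))) := by
    have h4 : ∀ u : A ⊗[ℂ] (A ⊗[ℂ] A), (LinearMap.mulLeft ℂ e).rTensor (A ⊗[ℂ] A)
      (H.T₁.toLinearMap.lTensor A u) = H.T₁.toLinearMap.lTensor A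
        ((LinearMap.mulLeft ℂ e).rTensor (A ⊗[ℂ] A) u) := fun u =>
      (TensorProduct.lTensor_rTensor _ _ _).symm
    rw [h4]
    congr 1
    clear hs
    induction s with
    | zero => simp
    | add x y hx hy =>
      simp only [map_add, TensorProduct.tmul_add, hx, hy, LinearMap.lTensor_add,
        LinearMap.add_apply]
    | tmul x y =>
      have h2 : ∀ v : A ⊗[ℂ] A, (LinearMap.mulLeft ℂ e).rTensor (A ⊗[ℂ] A)
          (TensorProduct.assoc ℂ A A A (v ⊗ₜ y)) =
          TensorProduct.assoc ℂ A A A ((LinearMap.mulLeft ℂ e).rTensor A v ⊗ₜ y) := by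
        intro v
        induction v with
        | zero => simp
        | add x y hx hy => simp only [map_add, hx, hy, TensorProduct.add_tmul]
        | tmul p q => simp
      simp only [TensorProduct.assoc_symm_tmul, LinearMap.rTensor_tmul, LinearEquiv.coe_coe]
      rw [h2, H.mulLeft_T₁]
      induction H.T₂ (e ⊗ₜ a) with
      | zero => simp
      | add x y hx hy => simp only [map_add, hx, hy, TensorProduct.add_tmul]
      | tmul p q => simp
  rw [h3]
  simp only [LinearMap.rTensor_tmul, LinearMap.comp_apply,
        TensorProduct.mk_apply, LinearEquiv.coe_coe]
  induction H.T₂ (e ⊗ₜ a) with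
  | zero => simp
  | add x y hx hy => simp only [map_add, hx, hy, TensorProduct.add_tmul]
  | tmul p q =>
    have h5 : (LinearMap.rTensorHom A (LinearMap.mul ℂ A q) : A ⊗[ℂ] A →ₗ[ℂ] A ⊗[ℂ] A) s =
      (LinearMap.mulLeft ℂ q).rTensor A s := rfl
    simp only [LinearMap.lTensor_tmul, LinearMap.flip_apply, LinearMap.comp_apply, h5,
      LinearEquiv.coe_coe, H.T₁_rTensor_mulLeft, hs, TensorProduct.assoc_tmul, H.Δ_left_tmul]

namespace ModuleAlgebra

open RegularMultiplierHopfAlgebra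

variable {A : Type u} [NonUnitalRing A] [Module ℂ A] [IsScalarTower ℂ A A] [SMulCommClass ℂ A A]
  {H : RegularMultiplierHopfAlgebra A}
  {R : Type v} [NonUnitalRing R] [Module ℂ R] [IsScalarTower ℂ R R] [SMulCommClass ℂ R R]
  (X : ModuleAlgebra H R)

theorem lift_act_surjective : Function.Surjective (TensorProduct.lift X.act) := by
  rw [← LinearMap.range_eq_top, eq_top_iff, ← X.unital, Submodule.span_le]
  rintro _ ⟨a, x, rfl⟩
  exact ⟨a ⊗ₜ x, by simp⟩

theorem act_induction {p : R → Prop} (h0 : p 0) (hadd : ∀ x y, p x → p y → p (x + y))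
    (hact : ∀ a x, p (X.act a x)) (x : R) : p x := by
  obtain ⟨t, rfl⟩ := X.lift_act_surjective x
  induction t with
  | zero => simpa using h0
  | add x y hx hy => rw [map_add]; exact hadd _ _ hx hy
  | tmul a x => simpa using hact a x

theorem act_flip_act (c : A) (y : R) :
    X.act.flip (X.act c y) = X.act.flip y ∘ₗ LinearMap.mulRight ℂ c := by
  ext a
  simp [X.mul_act]

/-- A map `T` of `A ⊗ A` with `(d ⊗ 1) T(a ⊗ c) ∈ (A ⊗ A)(1 ⊗ c)`, in a way that is uniform in
`c`, descends along the action `A ⊗ R → R`. -/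
theorem exists_descent (T : A ⊗[ℂ] A →ₗ[ℂ] A ⊗[ℂ] A) (K : A → A → A ⊗[ℂ] A)
    (hK : ∀ d a c, (LinearMap.mulLeft ℂ d).rTensor A (T (a ⊗ₜ c)) =
      (LinearMap.mulRight ℂ c).lTensor A (K d a)) :
    ∃ W : A ⊗[ℂ] R →ₗ[ℂ] A ⊗[ℂ] R, ∀ a c y,
      W (a ⊗ₜ X.act c y) = (X.act.flip y).lTensor A (T (a ⊗ₜ c)) := by
  -- A linear section chooses a decomposition x = ∑ cy. The identity `hd` below shows the choice is
  -- immaterial: after multiplication by d the value depends on ∑ cy only.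
  obtain ⟨σ, hσ⟩ := (TensorProduct.lift X.act).exists_rightInverse_of_surjective
    (LinearMap.range_eq_top.2 X.lift_act_surjective)
  let Ψ : A ⊗[ℂ] (A ⊗[ℂ] R) →ₗ[ℂ] A ⊗[ℂ] R := (TensorProduct.lift X.act).lTensor A ∘ₗ
    (TensorProduct.assoc ℂ A A R).toLinearMap ∘ₗ T.rTensor R ∘ₗ
    (TensorProduct.assoc ℂ A A R).symm.toLinearMap
  have hΨ : ∀ a c y, Ψ (a ⊗ₜ (c ⊗ₜ y)) = (X.act.flip y).lTensor A (T (a ⊗ₜ c)) := by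
    intro a c y
    simp only [Ψ, LinearMap.comp_apply, LinearEquiv.coe_coe, TensorProduct.assoc_symm_tmul,
      LinearMap.rTensor_tmul]
    induction T (a ⊗ₜ c) with
    | zero => simp
    | add x y hx hy => simp only [map_add, hx, hy, TensorProduct.add_tmul]
    | tmul p q => simp
  have hd : ∀ d a u, (LinearMap.mulLeft ℂ d).rTensor R (Ψ (a ⊗ₜ u)) =
      (X.act.flip (TensorProduct.lift X.act u)).lTensor A (K d a) := by
    intro d a u
    induction u with
    | zero => simp
    | add x y hx hy =>
      simp only [map_add, hx, hy, TensorProduct.tmul_add, LinearMap.lTensor_add,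
        LinearMap.add_apply]
    | tmul c y =>
      rw [hΨ, ← TensorProduct.lTensor_rTensor, hK, ← LinearMap.lTensor_comp_apply,
        TensorProduct.lift.tmul, act_flip_act]
  refine ⟨Ψ ∘ₗ σ.lTensor A, fun a c y => H.nondegenerate.eq_of_mulLeft_rTensor fun d => ?_⟩
  have h1 : TensorProduct.lift X.act (σ (X.act c y)) = X.act c y :=
    LinearMap.congr_fun hσ _
  rw [LinearMap.comp_apply, LinearMap.lTensor_tmul, hd, h1, ← hΨ, hd, TensorProduct.lift.tmul]

/-- Both the opposite T₁ and its inverse descend along A ⊗ R → R, the inverse because of its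
expression through the antipode; the two descended maps are mutually inverse. -/
theorem exists_cross : ∃ w : A ⊗[ℂ] R ≃ₗ[ℂ] R ⊗[ℂ] A, ∀ a c y,
    w (a ⊗ₜ X.act c y) = (X.act.flip y).rTensor A (H.T₃ (a ⊗ₜ c)) := by
  obtain ⟨W, hW⟩ := X.exists_descent H.opp.T₁.toLinearMap _ fun d a c => H.opp.mulLeft_T₁ d a c
  obtain ⟨V, hV⟩ := X.exists_descent H.opp.T₁.symm.toLinearMap _
    fun d a c => H.opp.mulLeft_T₁_symm_eq d a c
  have h : ∀ (f g : A ⊗[ℂ] R →ₗ[ℂ] A ⊗[ℂ] R) (T U : A ⊗[ℂ] A →ₗ[ℂ] A ⊗[ℂ] A),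
      (∀ a c y, f (a ⊗ₜ X.act c y) = (X.act.flip y).lTensor A (T (a ⊗ₜ c))) →
      (∀ a c y, g (a ⊗ₜ X.act c y) = (X.act.flip y).lTensor A (U (a ⊗ₜ c))) →
      T ∘ₗ U = LinearMap.id → f ∘ₗ g = LinearMap.id := by
    intro f g T U hf hg hTU
    have hf' : ∀ y t, f ((X.act.flip y).lTensor A t) = (X.act.flip y).lTensor A (T t) := by
      intro y t
      induction t with
      | zero => simp
      | add x y hx hy => simp only [map_add, hx, hy]
      | tmul a c => simp [hf]
    refine TensorProduct.ext' fun a x => ?_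
    induction x using X.act_induction with
    | h0 => simp
    | hadd x y hx hy => simp only [TensorProduct.tmul_add, map_add, hx, hy]
    | hact c y =>
      rw [LinearMap.comp_apply, hg, hf', ← LinearMap.comp_apply T, hTU]
      simp
  let e : A ⊗[ℂ] R ≃ₗ[ℂ] A ⊗[ℂ] R := LinearEquiv.ofLinearMap W V
    (h W V _ _ hW hV (by ext; simp)) (h V W _ _ hV hW (by ext; simp))
  refine ⟨e.trans (TensorProduct.comm ℂ A R), fun a c y => ?_⟩
  change TensorProduct.comm ℂ A R (W _) = _
  rw [hW, TensorProduct.comm_lTensor, T₃_apply]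
  rfl

/-- The map `a ⊗ x ↦ ∑ a₁ x ⊗ a₂`, expressing the product `(1 # a)(x # 1)` in `R # A`. -/
def cross : A ⊗[ℂ] R ≃ₗ[ℂ] R ⊗[ℂ] A := X.exists_cross.choose

theorem cross_act (a c : A) (y : R) :
    X.cross (a ⊗ₜ X.act c y) = (X.act.flip y).rTensor A (H.T₃ (a ⊗ₜ c)) :=
  X.exists_cross.choose_spec a c y

/-- Covering the leg A by b removes the need to decompose x, and by non-degeneracy of A it
determines `cross`. -/
theorem mulRight_cross (a b : A) (x : R) :
    (LinearMap.mulRight ℂ b).lTensor R (X.cross (a ⊗ₜ x)) =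
      (X.act.flip x).rTensor A (H.T₁ (a ⊗ₜ b)) := by
  induction x using X.act_induction with
  | h0 => simp
  | hadd x y hx hy =>
    simp only [TensorProduct.tmul_add, map_add, hx, hy, LinearMap.rTensor_add,
      LinearMap.add_apply]
  | hact c y =>
    rw [cross_act, TensorProduct.lTensor_rTensor, mulRight_T₃, act_flip_act,
      LinearMap.rTensor_comp_apply]

/-- The hypothesis says Δ ∘ g = (ι ⊗ g)Δ; it is applied to g = b ▷. -/
theorem lTensor_cross (g : A →ₗ[ℂ] A)
    (hg : ∀ a c, H.T₃ (g a ⊗ₜ c) = g.lTensor A (H.T₃ (a ⊗ₜ c))) (t : A ⊗[ℂ] R) :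
    g.lTensor R (X.cross t) = X.cross (g.rTensor R t) := by
  induction t with
  | zero => simp
  | add x y hx hy => simp only [map_add, hx, hy]
  | tmul a x =>
    induction x using X.act_induction with
    | h0 => simp
    | hadd x y hx hy => simp only [TensorProduct.tmul_add, map_add, hx, hy]
    | hact c y =>
      rw [LinearMap.rTensor_tmul, cross_act, cross_act, TensorProduct.lTensor_rTensor, hg]

/-- Left multiplication by `1 # a` in `R # A`. -/
def leftMul (a : A) : R ⊗[ℂ] A →ₗ[ℂ] R ⊗[ℂ] A :=
  TensorProduct.lift (LinearMap.lcomp ℂ (R ⊗[ℂ] A) (H.T₁.toLinearMap ∘ₗ TensorProduct.mk ℂ A A a) ∘ₗ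
    LinearMap.rTensorHom A ∘ₗ X.act.flip)

theorem leftMul_tmul (a b : A) (y : R) :
    X.leftMul a (y ⊗ₜ b) = (X.act.flip y).rTensor A (H.T₁ (a ⊗ₜ b)) := by
  simp only [leftMul, TensorProduct.lift.tmul]
  rfl

/-- Right multiplication by `x # 1` in `R # A`. -/
def rightMul (x : R) : R ⊗[ℂ] A →ₗ[ℂ] R ⊗[ℂ] A :=
  TensorProduct.lift (LinearMap.lcomp ℂ (R ⊗[ℂ] A)
    (X.cross.toLinearMap ∘ₗ (TensorProduct.mk ℂ A R).flip x) ∘ₗ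
    LinearMap.rTensorHom A ∘ₗ LinearMap.mul ℂ R)

theorem rightMul_tmul (x y : R) (b : A) :
    X.rightMul x (y ⊗ₜ b) = (LinearMap.mulLeft ℂ y).rTensor A (X.cross (b ⊗ₜ x)) := by
  simp only [rightMul, TensorProduct.lift.tmul]
  rfl

theorem leftMul_mulRight (a d : A) (t : R ⊗[ℂ] A) :
    X.leftMul a ((LinearMap.mulRight ℂ d).lTensor R t) =
      (LinearMap.mulRight ℂ d).lTensor R (X.leftMul a t) := by
  induction t with
  | zero => simp
  | add x y hx hy => simp only [map_add, hx, hy]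
  | tmul y b =>
    rw [LinearMap.lTensor_tmul, leftMul_tmul, leftMul_tmul, LinearMap.mulRight_apply,
      H.T₁_mulRight, TensorProduct.lTensor_rTensor]

theorem leftMul_cross (a a' : A) (x : R) :
    X.leftMul a (X.cross (a' ⊗ₜ x)) = X.cross ((a * a') ⊗ₜ x) := by
  refine H.nondegenerate.eq_of_mulRight_lTensor fun d => ?_
  rw [← leftMul_mulRight, mulRight_cross, mulRight_cross, H.T₁_mul_tmul]
  induction H.T₁ (a' ⊗ₜ d) with
  | zero => simp
  | add x y hx hy => simp only [map_add, hx, hy]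
  | tmul p q =>
    rw [LinearMap.rTensor_tmul, leftMul_tmul, H.Δ_left_tmul, LinearMap.flip_apply, act_flip_act,
      LinearMap.rTensor_comp_apply]

theorem leftMul_mul (a a' : A) (t : R ⊗[ℂ] A) :
    X.leftMul (a * a') t = X.leftMul a (X.leftMul a' t) := by
  obtain ⟨t, rfl⟩ := X.cross.surjective t
  induction t with
  | zero => simp
  | add x y hx hy => simp only [map_add, hx, hy]
  | tmul b x => rw [leftMul_cross, leftMul_cross, leftMul_cross, mul_assoc]

theorem rightMul_add (x x' : R) (t : R ⊗[ℂ] A) :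
    X.rightMul (x + x') t = X.rightMul x t + X.rightMul x' t := by
  induction t with
  | zero => simp
  | add y z hy hz => rw [map_add, hy, hz, map_add, map_add]; abel
  | tmul z b => simp only [rightMul_tmul, TensorProduct.tmul_add, map_add]

theorem rightMul_zero (t : R ⊗[ℂ] A) : X.rightMul 0 t = 0 := by
  simpa using X.rightMul_add 0 0 t

/-- For x' = cz, the axiom for a(x(cz)) involves an iterated coproduct, and the pentagon equation
identifies it with applying the exchange twice. -/
theorem rightMul_cross (a : A) (x x' : R) :
    X.rightMul x' (X.cross (a ⊗ₜ x)) = X.cross (a ⊗ₜ (x * x')) := by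
  induction x' using X.act_induction with
  | h0 => simp [rightMul_zero]
  | hadd y z hy hz => simp only [rightMul_add, mul_add, TensorProduct.tmul_add, map_add, hy, hz]
  | hact c z =>
    refine H.nondegenerate.eq_of_mulRight_lTensor fun d => ?_
    obtain ⟨s, hs⟩ := H.T₁.surjective (c ⊗ₜ d)
    let E : A ⊗[ℂ] (A ⊗[ℂ] A) →ₗ[ℂ] R ⊗[ℂ] A :=
      TensorProduct.lift (LinearMap.lcomp ℂ (R ⊗[ℂ] A) ((X.act.flip z).rTensor A) ∘ₗ
        LinearMap.rTensorHom A ∘ₗ LinearMap.mul ℂ R ∘ₗ X.act.flip x)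
    have hE : ∀ (p : A) (u : A ⊗[ℂ] A), E (p ⊗ₜ u) =
        (LinearMap.mulLeft ℂ (X.act p x)).rTensor A ((X.act.flip z).rTensor A u) := by
      intro p u
      simp only [E, TensorProduct.lift.tmul]
      rfl
    have h1 : ∀ u : A ⊗[ℂ] A, (X.act.flip (x * X.act c z)).rTensor A u =
        E (TensorProduct.assoc ℂ A A A
          ((H.T₁.toLinearMap ∘ₗ (TensorProduct.mk ℂ A A).flip c).rTensor A u)) := by
      intro u
      induction u with
      | zero => simp
      | add x y hx hy => simp only [map_add, hx, hy]
      | tmul p q =>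
        rw [LinearMap.rTensor_tmul, LinearMap.flip_apply, X.act_mul]
        simp only [LinearMap.rTensor_tmul, LinearMap.comp_apply, LinearMap.flip_apply,
          TensorProduct.mk_apply, LinearEquiv.coe_coe]
        induction H.T₁ (p ⊗ₜ c) with
        | zero => simp
        | add x y hx hy => simp only [map_add, hx, hy, TensorProduct.add_tmul]
        | tmul p' q' => simp [hE]
    -- Right multiplication by cz # 1, then by d, rewritten in terms of s = T₁⁻¹(c ⊗ d). After the
    -- pentagon both sides are linear in s, so s may be replaced by a pure tensor.
    let D (s : A ⊗[ℂ] A) : R ⊗[ℂ] A →ₗ[ℂ] R ⊗[ℂ] A :=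
      TensorProduct.lift (LinearMap.lcomp ℂ (R ⊗[ℂ] A)
        ((X.act.flip z).rTensor A ∘ₗ H.T₁.toLinearMap ∘ₗ
          (LinearMap.rTensorHom A ∘ₗ LinearMap.mul ℂ A :
            A →ₗ[ℂ] A ⊗[ℂ] A →ₗ[ℂ] A ⊗[ℂ] A).flip s) ∘ₗ
        LinearMap.rTensorHom A ∘ₗ LinearMap.mul ℂ R)
    have hD : ∀ (s : A ⊗[ℂ] A) (y : R) (b : A), D s (y ⊗ₜ b) =
        (LinearMap.mulLeft ℂ y).rTensor A ((X.act.flip z).rTensor A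
          (H.T₁ ((LinearMap.mulLeft ℂ b).rTensor A s))) := by
      intro s y b
      simp only [D, TensorProduct.lift.tmul]
      rfl
    have h2 : ∀ v : R ⊗[ℂ] A, (LinearMap.mulRight ℂ d).lTensor R (X.rightMul (X.act c z) v) =
        D s v := by
      intro v
      induction v with
      | zero => simp
      | add x y hx hy => simp only [map_add, hx, hy]
      | tmul y b =>
        rw [rightMul_tmul, cross_act, TensorProduct.lTensor_rTensor, TensorProduct.lTensor_rTensor,
          ← H.Δ_left_tmul', ← hs, ← H.T₁_rTensor_mulLeft, hD]
    have hDadd : ∀ (s t : A ⊗[ℂ] A) (v : R ⊗[ℂ] A), D (s + t) v = D s v + D t v := by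
      intro s t v
      induction v with
      | zero => simp
      | add x y hx hy => rw [map_add, hx, hy, map_add, map_add]; abel
      | tmul y b => simp only [hD, map_add]
    rw [h2, mulRight_cross, h1, H.pentagon a c d s hs]
    clear hs h2
    induction s with
    | zero => simpa using hDadd 0 0 (X.cross (a ⊗ₜ x))
    | add s t hs ht => rw [hDadd, hs, ht, TensorProduct.tmul_add]; simp only [map_add]
    | tmul e f =>
      let Z : R ⊗[ℂ] A →ₗ[ℂ] R ⊗[ℂ] A :=
        TensorProduct.lift (LinearMap.lcomp ℂ (R ⊗[ℂ] A)
          ((X.act.flip z).rTensor A ∘ₗ H.T₁.toLinearMap ∘ₗ (TensorProduct.mk ℂ A A).flip f) ∘ₗ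
          LinearMap.rTensorHom A ∘ₗ LinearMap.mul ℂ R)
      have hZ : ∀ (y : R) (b : A), Z (y ⊗ₜ b) =
          (LinearMap.mulLeft ℂ y).rTensor A ((X.act.flip z).rTensor A (H.T₁ (b ⊗ₜ f))) := by
        intro y b
        simp only [Z, TensorProduct.lift.tmul]
        rfl
      have h3 : ∀ v, D (e ⊗ₜ f) v = Z ((LinearMap.mulRight ℂ e).lTensor R v) := by
        intro v
        induction v with
        | zero => simp
        | add x y hx hy => simp only [map_add, hx, hy]
        | tmul y b => rw [hD, LinearMap.lTensor_tmul, hZ]; simp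
      have h4 : ∀ u : A ⊗[ℂ] A, Z ((X.act.flip x).rTensor A u) =
          E (H.T₁.toLinearMap.lTensor A (TensorProduct.assoc ℂ A A A (u ⊗ₜ f))) := by
        intro u
        induction u with
        | zero => simp
        | add x y hx hy => simp only [map_add, hx, hy, TensorProduct.add_tmul]
        | tmul p q => rw [LinearMap.rTensor_tmul, hZ]; simp [hE]
      rw [h3, mulRight_cross, h4]
      simp

theorem rightMul_cross_apply (x : R) (t : A ⊗[ℂ] R) :
    X.rightMul x (X.cross t) = X.cross ((LinearMap.mulRight ℂ x).lTensor A t) := by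
  induction t with
  | zero => simp
  | add y z hy hz => simp only [map_add, hy, hz]
  | tmul a y => rw [rightMul_cross]; simp

end ModuleAlgebra

/-! ### The smash product and the canonical embedding of M(R). -/

namespace SmashProduct

open ModuleAlgebra

variable {A : Type u} [NonUnitalRing A] [Module ℂ A] [IsScalarTower ℂ A A] [SMulCommClass ℂ A A]
  {H : RegularMultiplierHopfAlgebra A}
  {R : Type v} [NonUnitalRing R] [Module ℂ R] [IsScalarTower ℂ R R] [SMulCommClass ℂ R R]
  (X : ModuleAlgebra H R)

theorem mulTensor_leftMul (x : R) (a : A) (t : R ⊗[ℂ] A) :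
    mulTensor X (x ⊗ₜ a) t = (LinearMap.mulLeft ℂ x).rTensor A (X.leftMul a t) := by
  induction t with
  | zero => simp
  | add y z hy hz => simp only [map_add, hy, hz]
  | tmul y b => rw [mulTensor_tmul, leftMul_tmul, LinearMap.rTensor_comp_apply]

theorem mulTensor_rightMul (s : R ⊗[ℂ] A) (x : R) (a : A) :
    mulTensor X s (x ⊗ₜ a) = (LinearMap.mulRight ℂ a).lTensor R (X.rightMul x s) := by
  induction s with
  | zero => simp
  | add y z hy hz => simp only [map_add, LinearMap.add_apply, hy, hz]
  | tmul y b => rw [mulTensor_tmul, rightMul_tmul, TensorProduct.lTensor_rTensor, mulRight_cross,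
      LinearMap.rTensor_comp_apply]

theorem mulTensor_mulRight (s t : R ⊗[ℂ] A) (a : A) :
    mulTensor X ((LinearMap.mulRight ℂ a).lTensor R s) t = mulTensor X s (X.leftMul a t) := by
  induction s with
  | zero => simp
  | add y z hy hz => simp only [map_add, LinearMap.add_apply, hy, hz]
  | tmul y b => rw [LinearMap.lTensor_tmul, LinearMap.mulRight_apply, mulTensor_leftMul,
      mulTensor_leftMul, leftMul_mul]

theorem mulTensor_cross (s : R ⊗[ℂ] A) (a : A) (x : R) :
    mulTensor X s (X.cross (a ⊗ₜ x)) =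
      X.rightMul x ((LinearMap.mulRight ℂ a).lTensor R s) := by
  induction s with
  | zero => simp
  | add y z hy hz => simp only [map_add, LinearMap.add_apply, hy, hz]
  | tmul y b => rw [mulTensor_leftMul, leftMul_cross, LinearMap.lTensor_tmul, rightMul_tmul,
      LinearMap.mulRight_apply]

/-- Right multiplication by x # a is right multiplication by x on the leg R, seen through `cross`,
followed by a on the leg A; each can be cancelled in turn. -/
theorem mulTensor_left_nondegenerate (hR : NondegenerateProduct R) {s t : R ⊗[ℂ] A}
    (h : ∀ u, mulTensor X s u = mulTensor X t u) : s = t := by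
  obtain ⟨s, rfl⟩ := X.cross.surjective s
  obtain ⟨t, rfl⟩ := X.cross.surjective t
  congr 1
  refine hR.eq_of_mulRight_lTensor fun x => X.cross.injective ?_
  rw [← rightMul_cross_apply, ← rightMul_cross_apply]
  refine H.nondegenerate.eq_of_mulRight_lTensor fun a => ?_
  rw [← mulTensor_rightMul, ← mulTensor_rightMul, h]

/-- Right multiplication in `R # A` by a multiplier of `R`. -/
def embedRight (m : Multiplier R) : R ⊗[ℂ] A →ₗ[ℂ] R ⊗[ℂ] A :=
  X.cross.toLinearMap ∘ₗ m.right.lTensor A ∘ₗ X.cross.symm.toLinearMap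

/-- The form (1 # a)(x # 1) has R on the right, so m multiplies it as (1 # a)(xm # 1). -/
theorem embedRight_cross (m : Multiplier R) (t : A ⊗[ℂ] R) :
    embedRight X m (X.cross t) = X.cross (m.right.lTensor A t) := by
  simp [embedRight]

theorem embedRight_rightMul (m : Multiplier R) (x : R) (s : R ⊗[ℂ] A) :
    embedRight X m (X.rightMul x s) = X.rightMul (m.right x) s := by
  obtain ⟨s, rfl⟩ := X.cross.surjective s
  rw [rightMul_cross_apply, embedRight_cross, rightMul_cross_apply, ← LinearMap.lTensor_comp_apply]
  congr 3
  ext y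
  simp [m.right_mul]

theorem rightMul_embedRight (m : Multiplier R) (x : R) (s : R ⊗[ℂ] A) :
    X.rightMul x (embedRight X m s) = X.rightMul (m.left x) s := by
  obtain ⟨s, rfl⟩ := X.cross.surjective s
  rw [embedRight_cross, rightMul_cross_apply, rightMul_cross_apply, ← LinearMap.lTensor_comp_apply]
  congr 3
  ext y
  simp [m.right_mul_eq]

theorem embedLeft_mul (m : Multiplier R) (s t : R ⊗[ℂ] A) :
    m.left.rTensor A (mulTensor X s t) = mulTensor X (m.left.rTensor A s) t := by
  induction s with
  | zero => simp
  | add y z hy hz => simp only [map_add, LinearMap.add_apply, hy, hz]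
  | tmul x a =>
    rw [LinearMap.rTensor_tmul, mulTensor_leftMul, mulTensor_leftMul,
      ← LinearMap.rTensor_comp_apply]
    congr 2
    ext y
    simp [m.left_mul]

theorem embedRight_mul (m : Multiplier R) (s t : R ⊗[ℂ] A) :
    embedRight X m (mulTensor X s t) = mulTensor X s (embedRight X m t) := by
  obtain ⟨t, rfl⟩ := X.cross.surjective t
  induction t with
  | zero => simp
  | add y z hy hz => simp only [map_add, hy, hz]
  | tmul a x => rw [mulTensor_cross, embedRight_rightMul, embedRight_cross, LinearMap.lTensor_tmul,
      mulTensor_cross]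

theorem embedRight_mul_eq (m : Multiplier R) (s t : R ⊗[ℂ] A) :
    mulTensor X (embedRight X m s) t = mulTensor X s (m.left.rTensor A t) := by
  induction t with
  | zero => simp
  | add y z hy hz => simp only [map_add, hy, hz]
  | tmul x a => rw [mulTensor_rightMul, rightMul_embedRight, LinearMap.rTensor_tmul,
      mulTensor_rightMul]

/-- The multiplier of `R # A` given by a multiplier of `R`. -/
def embed (m : Multiplier R) : Multiplier (SmashProduct X) :=
  Multiplier.mk' (A := SmashProduct X) (m.left.rTensor A : R ⊗[ℂ] A →ₗ[ℂ] R ⊗[ℂ] A)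
    (embedRight X m) (embedLeft_mul X m) (embedRight_mul X m) (embedRight_mul_eq X m)

end SmashProduct

/-- The right component is determined by the left one through (am)c = a(mc). This lets the
homomorphism laws of π be checked on left components alone. -/
theorem Multiplier.ext_left {C : Type u} [NonUnitalNonAssocRing C] [Module ℂ C]
    [IsScalarTower ℂ C C] [SMulCommClass ℂ C C] (hC : ∀ a b : C, (∀ c, a * c = b * c) → a = b)
    {m n : Multiplier C} (h : ∀ a, m.left a = n.left a) : m = n := by
  apply Subtype.ext
  apply Prod.ext
  · exact LinearMap.ext h
  · apply MulOpposite.unop_injective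
    refine LinearMap.ext fun a => hC _ _ fun c => ?_
    change m.right a * c = n.right a * c
    rw [m.right_mul_eq, n.right_mul_eq, h]

namespace SmashProduct

variable {A : Type u} [NonUnitalRing A] [Module ℂ A] [IsScalarTower ℂ A A] [SMulCommClass ℂ A A]
  {H : RegularMultiplierHopfAlgebra A}
  {R : Type v} [NonUnitalRing R] [Module ℂ R] [IsScalarTower ℂ R R] [SMulCommClass ℂ R R]
  (X : ModuleAlgebra H R)

theorem mul_def (s t : SmashProduct X) : s * t = mulTensor X s t := rfl

theorem mul_left_nondegenerate (hR : NondegenerateProduct R) (s t : SmashProduct X)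
    (h : ∀ u, s * u = t * u) : s = t :=
  mulTensor_left_nondegenerate X hR fun u =>
    (mul_def X s u).symm.trans ((h u).trans (mul_def X t u))

theorem multiplier_ext (hR : NondegenerateProduct R) {m n : Multiplier (SmashProduct X)}
    (h : ∀ x a, m.left (mk X x a) = n.left (mk X x a)) : m = n := by
  refine Multiplier.ext_left (mul_left_nondegenerate X hR) fun s => ?_
  exact LinearMap.congr_fun (f := (m.left : R ⊗[ℂ] A →ₗ[ℂ] R ⊗[ℂ] A))
    (g := (n.left : R ⊗[ℂ] A →ₗ[ℂ] R ⊗[ℂ] A)) (TensorProduct.ext' h) s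

theorem embed_left_mk (m : Multiplier R) (x : R) (a : A) :
    (embed X m).left (mk X x a) = mk X (m.left x) a := rfl

/-- The canonical embedding `M(R) → M(R # A)`. -/
def embedHom (hR : NondegenerateProduct R) : Multiplier R →ₐ[ℂ] Multiplier (SmashProduct X) where
  toFun := embed X
  map_one' := multiplier_ext X hR fun _ _ => rfl
  map_mul' _ _ := multiplier_ext X hR fun _ _ => rfl
  map_zero' := multiplier_ext X hR fun _ _ => TensorProduct.zero_tmul _ _
  map_add' _ _ := multiplier_ext X hR fun _ _ => TensorProduct.add_tmul _ _ _
  commutes' _ := multiplier_ext X hR fun _ _ => rfl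

theorem embedHom_injective (hR : NondegenerateProduct R) :
    Function.Injective (embedHom X hR) := by
  intro m n h
  refine Multiplier.ext_left (fun a b hab => ?_) fun x => ?_
  · rw [← sub_eq_zero]
    exact hR.1 _ fun c => by rw [sub_mul, hab, sub_self]
  have h1 : ∀ (x : R) (a : A), m.left x ⊗ₜ[ℂ] a = n.left x ⊗ₜ[ℂ] a := fun x a =>
    congrArg (fun k => k.left (mk X x a)) h
  -- If A = 0 then R = AR = 0; otherwise a functional that is nonzero on some a recovers mx from mx
  -- ⊗ a.
  rcases subsingleton_or_nontrivial A with hA | hA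
  · induction x using X.act_induction with
    | h0 => simp
    | hadd y z hy hz => rw [map_add, map_add, hy, hz]
    | hact a y => rw [Subsingleton.elim a 0]; simp
  · obtain ⟨a, ha⟩ := exists_ne (0 : A)
    obtain ⟨φ, hφ⟩ := Module.Projective.exists_dual_ne_zero ℂ ha
    have h2 := congrArg (TensorProduct.rid ℂ R ∘ φ.lTensor R) (h1 x a)
    simp only [Function.comp_apply, LinearMap.lTensor_tmul, TensorProduct.rid_tmul] at h2
    exact smul_right_injective R hφ h2

end SmashProduct

/-! ### Fixed points as multipliers commuting with the action. -/

theorem lift_compl₂_comp {B : Type u} [AddCommGroup B] [Module ℂ B] {C : Type v} [AddCommGroup C]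
    [Module ℂ C] (act : B →ₗ[ℂ] C →ₗ[ℂ] C) (g : B →ₗ[ℂ] C) (f : B →ₗ[ℂ] B) (t : B ⊗[ℂ] B) :
    TensorProduct.lift (act.compl₂ (g ∘ₗ f)) t =
      TensorProduct.lift (act.compl₂ g) (f.lTensor B t) := by
  induction t with
  | zero => simp
  | add x y hx hy => simp only [map_add, hx, hy]
  | tmul x y => simp

/-- `∑ b₁ f(S(b₂) x) = ε(b) f(x)` for all `x = S(c) y` if and only if `f` commutes with `b` on the
elements `d y`. -/
theorem invariant_iff {B : Type u} [NonUnitalRing B] [Module ℂ B] [IsScalarTower ℂ B B]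
    [SMulCommClass ℂ B B] (H : RegularMultiplierHopfAlgebra B) {C : Type v} [AddCommGroup C]
    [Module ℂ C] (act : B →ₗ[ℂ] C →ₗ[ℂ] C) (f : C →ₗ[ℂ] C) (y : C) :
    (∀ b c, H.counit b • f (act (H.antipode c) y) =
      TensorProduct.lift (act.compl₂ (f ∘ₗ act.flip y ∘ₗ H.antipode.toLinearMap))
        (H.T₄ (c ⊗ₜ b))) ↔
    ∀ b d, act b (f (act d y)) = f (act (b * d) y) := by
  -- The antipode is absorbed into T₁⁻¹, because (ι ⊗ S)((1 ⊗ c)Δ(b)) = T₁⁻¹(b ⊗ S(c)).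
  have h1 : ∀ b c, TensorProduct.lift
      (act.compl₂ (f ∘ₗ act.flip y ∘ₗ H.antipode.toLinearMap)) (H.T₄ (c ⊗ₜ b)) =
      TensorProduct.lift (act.compl₂ (f ∘ₗ act.flip y)) (H.T₁.symm (b ⊗ₜ H.antipode c)) := by
    intro b c
    rw [H.T₁_symm_antipode, ← lift_compl₂_comp, LinearMap.comp_assoc]
  simp only [h1]
  constructor
  · intro h b d
    -- S is onto, so the hypothesis extends to all of A ⊗ A-type tensors t in B ⊗ B; evaluating at t
    -- = T₁(b ⊗ d) leaves the commutation relation.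
    have h2 : ∀ t, TensorProduct.lift (act.compl₂ (f ∘ₗ act.flip y)) (H.T₁.symm t) =
        f (act (sliceLeft H.counit t) y) := by
      intro t
      induction t with
      | zero => simp
      | add s t hs ht => simp only [map_add, hs, ht, LinearMap.add_apply]
      | tmul p q =>
        obtain ⟨c, rfl⟩ := H.antipode.surjective q
        rw [← h]
        simp [sliceLeft]
    have h3 := h2 (H.T₁ (b ⊗ₜ d))
    rw [H.sliceLeft_counit_T₁] at h3
    simpa using h3
  · intro h b c
    have h2 : ∀ t, TensorProduct.lift (act.compl₂ (f ∘ₗ act.flip y)) t =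
        f (act (LinearMap.mul' ℂ B t) y) := by
      intro t
      induction t with
      | zero => simp
      | add s t hs ht => simp only [map_add, hs, ht, LinearMap.add_apply]
      | tmul p q => simp [h]
    rw [h2, H.mul_T₁_symm]
    simp [sliceLeft]

/-- The condition on right multiplication is the left one for the opposite comultiplication, whose
counit is ε and whose antipode is S⁻¹. -/
theorem mem_fixedPoints_iff {B : Type u} [NonUnitalRing B] [Module ℂ B] [IsScalarTower ℂ B B]
    [SMulCommClass ℂ B B] (H : RegularMultiplierHopfAlgebra B) {C : Type v}
    [NonUnitalNonAssocRing C] [Module ℂ C] [IsScalarTower ℂ C C] [SMulCommClass ℂ C C]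
    (act : B →ₗ[ℂ] C →ₗ[ℂ] C) (m : Multiplier C) :
    m ∈ fixedPoints H act ↔
      (∀ b d y, act b (m.left (act d y)) = m.left (act (b * d) y)) ∧
      (∀ b d y, act b (m.right (act d y)) = m.right (act (b * d) y)) := by
  have hl := fun y => invariant_iff H act m.left y
  have hr := fun y => invariant_iff H.opp act m.right y
  simp only [H.opp_counit, H.opp_antipode, H.opp_T₄_apply] at hr
  have hflip : ∀ (g : B →ₗ[ℂ] C) (t : B ⊗[ℂ] B), TensorProduct.lift (act.compl₂ g).flip t =
      TensorProduct.lift (act.compl₂ g) (TensorProduct.comm ℂ B B t) := by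
    intro g t
    induction t with
    | zero => simp
    | add x y hx hy => simp only [map_add, hx, hy]
    | tmul x y => simp
  constructor
  · intro h
    refine ⟨fun b d y => (hl y).1 (fun b c => (h b c y).1) b d,
      fun b d y => (hr y).1 (fun b c => ?_) b d⟩
    rw [← hflip]
    exact (h b c y).2
  · rintro ⟨h1, h2⟩ b c y
    refine ⟨(hl y).2 (fun b d => h1 b d y) b c, ?_⟩
    rw [hflip]
    exact (hr y).2 (fun b d => h2 b d y) b c

/-! ### Fixed points of the dual action. -/

namespace SmashProduct

variable {A : Type u} [NonUnitalRing A] [Module ℂ A] [IsScalarTower ℂ A A] [SMulCommClass ℂ A A]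
  {B : Type w} [NonUnitalRing B] [Module ℂ B] [IsScalarTower ℂ B B] [SMulCommClass ℂ B B]
  {HA : RegularMultiplierHopfAlgebra A} {HB : RegularMultiplierHopfAlgebra B}
  (P : DualPair HA HB)
  {R : Type v} [NonUnitalRing R] [Module ℂ R] [IsScalarTower ℂ R R] [SMulCommClass ℂ R R]
  (X : ModuleAlgebra HA R)

theorem dualAction_mul (b b' : B) (t : SmashProduct X) :
    dualAction P X (b * b') t = dualAction P X b (dualAction P X b' t) := by
  have h : P.leftB (b * b') = P.leftB b ∘ₗ P.leftB b' := by
    ext a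
    simp [P.leftB_leftB]
  exact (congrArg (fun f => f.lTensor R t) h).trans (LinearMap.lTensor_comp_apply R _ _ t)

/-- On the left, m and b ▷ act on different legs; on the right, they do so after conjugation by
`cross`, which commutes with b ▷. -/
theorem embed_mem_fixedPoints (m : Multiplier R) : embed X m ∈ fixedPoints HB (dualAction P X) := by
  rw [mem_fixedPoints_iff]
  constructor
  · intro b d y
    rw [dualAction_mul]
    exact TensorProduct.lTensor_rTensor _ _ _
  · intro b d y
    rw [dualAction_mul]
    have h : ∀ t : R ⊗[ℂ] A, (P.leftB b).lTensor R (embedRight X m t) =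
        embedRight X m ((P.leftB b).lTensor R t) := by
      intro t
      obtain ⟨t, rfl⟩ := X.cross.surjective t
      rw [embedRight_cross, X.lTensor_cross _ (P.T₃_leftB b), X.lTensor_cross _ (P.T₃_leftB b),
        embedRight_cross, TensorProduct.lTensor_rTensor]
    exact h _

/-- A linear map of `R # A` commuting with the dual action and with right multiplications by
elements of `A` comes from a linear map of `R`. -/
theorem exists_eq_tmul_of_commute {R : Type v} [AddCommGroup R] [Module ℂ R] [Nontrivial A]
    (F : R ⊗[ℂ] A →ₗ[ℂ] R ⊗[ℂ] A)
    (hF : ∀ a t, F ((LinearMap.mulRight ℂ a).lTensor R t) =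
      (LinearMap.mulRight ℂ a).lTensor R (F t))
    (hB : ∀ b t, F ((P.leftB b).lTensor R t) = (P.leftB b).lTensor R (F t)) :
    ∃ f : R →ₗ[ℂ] R, ∀ x a, F (x ⊗ₜ a) = f x ⊗ₜ a := by
  obtain ⟨a₀, ha₀⟩ := exists_ne (0 : A)
  obtain ⟨φ, hφ⟩ := Module.Projective.exists_dual_ne_zero ℂ ha₀
  refine ⟨(φ a₀)⁻¹ • ((TensorProduct.rid ℂ R).toLinearMap ∘ₗ φ.lTensor R ∘ₗ F ∘ₗ
    (TensorProduct.mk ℂ R A).flip a₀), fun x a => TensorProduct.eq_of_slice_left fun ω => ?_⟩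
  have hnat : ∀ (g : A →ₗ[ℂ] A) (t : R ⊗[ℂ] A), TensorProduct.lid ℂ A (ω.rTensor A
      (g.lTensor R t)) = g (TensorProduct.lid ℂ A (ω.rTensor A t)) := by
    intro g t
    induction t with
    | zero => simp
    | add x y hx hy => simp only [map_add, hx, hy]
    | tmul x y => simp
  -- For fixed x and ω, the map a ↦ (ω ⊗ ι)F(x ⊗ a) is a scalar c. Slicing F(x ⊗ a₀) by φ shows that
  -- c is ω of the proposed f(x).
  obtain ⟨c, hc⟩ := P.exists_eq_smul_of_commute
    ((TensorProduct.lid ℂ A).toLinearMap ∘ₗ ω.rTensor A ∘ₗ F ∘ₗ TensorProduct.mk ℂ R A x)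
    (fun a a' => by
      have h := congrArg (fun t => TensorProduct.lid ℂ A (ω.rTensor A t)) (hF a' (x ⊗ₜ a))
      simp only [hnat, LinearMap.lTensor_tmul] at h
      exact h)
    (fun b a => by
      have h := congrArg (fun t => TensorProduct.lid ℂ A (ω.rTensor A t)) (hB b (x ⊗ₜ a))
      simp only [hnat, LinearMap.lTensor_tmul] at h
      exact h)
  simp only [LinearMap.comp_apply, TensorProduct.mk_apply, LinearEquiv.coe_coe] at hc
  have hswap : ∀ t : R ⊗[ℂ] A, ω (TensorProduct.rid ℂ R (φ.lTensor R t)) =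
      φ (TensorProduct.lid ℂ A (ω.rTensor A t)) := by
    intro t
    induction t with
    | zero => simp
    | add x y hx hy => simp only [map_add, hx, hy]
    | tmul x y => simp [mul_comm]
  rw [hc, LinearMap.rTensor_tmul, TensorProduct.lid_tmul]
  simp only [LinearMap.smul_apply, LinearMap.comp_apply, LinearMap.flip_apply,
    TensorProduct.mk_apply, LinearEquiv.coe_coe, map_smul, hswap, hc, smul_eq_mul]
  rw [mul_comm c, inv_mul_cancel_left₀ hφ]

/-- Only the left half of invariance is needed: it produces f, and the right component of m then
supplies the matching g. -/
theorem exists_embed_eq (hR : NondegenerateProduct R) (m : Multiplier (SmashProduct X))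
    (hm : m ∈ fixedPoints HB (dualAction P X)) : ∃ n : Multiplier R, embed X n = m := by
  rcases subsingleton_or_nontrivial A with hA | hA
  · refine ⟨0, multiplier_ext X hR fun x a => ?_⟩
    have h0 : mk X x a = 0 := by
      rw [Subsingleton.elim a 0]
      exact TensorProduct.tmul_zero _ _
    rw [h0, map_zero, map_zero]
  let F : R ⊗[ℂ] A →ₗ[ℂ] R ⊗[ℂ] A := m.left
  let G : R ⊗[ℂ] A →ₗ[ℂ] R ⊗[ℂ] A := m.right
  have hF : ∀ s t, F (mulTensor X s t) = mulTensor X (F s) t := m.left_mul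
  have hFG : ∀ s t, mulTensor X (G s) t = mulTensor X s (F t) := m.right_mul_eq
  have hFA : ∀ a t, F ((LinearMap.mulRight ℂ a).lTensor R t) =
      (LinearMap.mulRight ℂ a).lTensor R (F t) := by
    intro a t
    refine mulTensor_left_nondegenerate X hR fun u => ?_
    rw [← hF, mulTensor_mulRight, mulTensor_mulRight, hF]
  -- Invariance gives commutation only on elements d ▷ a; these span A.
  have hFB : ∀ b t, F ((P.leftB b).lTensor R t) = (P.leftB b).lTensor R (F t) := by
    intro b t
    have h := ((mem_fixedPoints_iff HB (dualAction P X) m).1 hm).1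
    simp only [dualAction_mul] at h
    induction t with
    | zero => simp
    | add x y hx hy => simp only [map_add, hx, hy]
    | tmul x a =>
      have ha : a ∈ Submodule.span ℂ {y : A | ∃ (b : B) (a : A), P.leftB b a = y} := by
        rw [P.span_leftB]; trivial
      induction ha using Submodule.span_induction with
      | zero => simp
      | add a a' _ _ ha ha' => simp only [TensorProduct.tmul_add, map_add, ha, ha']
      | smul c a _ ha => simp only [TensorProduct.tmul_smul, map_smul, ha]
      | mem a ha =>
        obtain ⟨d, a, rfl⟩ := ha
        exact (h b d (x ⊗ₜ a : R ⊗[ℂ] A)).symm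
  obtain ⟨f, hf⟩ := exists_eq_tmul_of_commute P F hFA hFB
  obtain ⟨a, ha⟩ := exists_ne (0 : A)
  obtain ⟨φ, hφ⟩ := Module.Projective.exists_dual_ne_zero ℂ ha
  -- In the form (1 # a)(x # 1), right multiplication by m should be x ↦ g(x) on the leg R; g is
  -- read off at one nonzero a by a functional φ.
  let g : R →ₗ[ℂ] R := (φ a)⁻¹ • ((TensorProduct.lid ℂ R).toLinearMap ∘ₗ φ.rTensor R ∘ₗ
    X.cross.symm.toLinearMap ∘ₗ G ∘ₗ X.cross.toLinearMap ∘ₗ TensorProduct.mk ℂ A R a)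
  have hgf : ∀ x y, g x * y = x * f y := by
    intro x y
    have h1 : X.rightMul y (G (X.cross (a ⊗ₜ x))) = X.cross (a ⊗ₜ (x * f y)) := by
      refine HA.nondegenerate.eq_of_mulRight_lTensor fun b => ?_
      rw [← mulTensor_rightMul, hFG, hf, mulTensor_rightMul, X.rightMul_cross]
    obtain ⟨u, hu⟩ := X.cross.surjective (G (X.cross (a ⊗ₜ x)))
    rw [← hu, X.rightMul_cross_apply, X.cross.injective.eq_iff] at h1
    have h2 := congrArg (TensorProduct.lid ℂ R ∘ φ.rTensor R) h1
    have h3 : TensorProduct.lid ℂ R (φ.rTensor R ((LinearMap.mulRight ℂ y).lTensor A u)) =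
        TensorProduct.lid ℂ R (φ.rTensor R u) * y := by
      clear h1 h2 hu
      induction u with
      | zero => simp
      | add x y hx hy => simp only [map_add, hx, hy, add_mul]
      | tmul x y => simp [smul_mul_assoc]
    simp only [Function.comp_apply, LinearMap.rTensor_tmul, TensorProduct.lid_tmul, h3] at h2
    have h4 : g x = (φ a)⁻¹ • TensorProduct.lid ℂ R (φ.rTensor R u) := by
      simp only [g, LinearMap.smul_apply, LinearMap.comp_apply, TensorProduct.mk_apply,
        LinearEquiv.coe_coe]
      rw [← hu, LinearEquiv.symm_apply_apply]
    rw [h4, smul_mul_assoc, h2, smul_smul, inv_mul_cancel₀ hφ, one_smul]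
  -- Both module properties follow from g(x)y = x f(y) by cancelling in R.
  have hfm : ∀ x y, f (x * y) = f x * y := by
    intro x y
    rw [← sub_eq_zero]
    refine hR.2 _ fun z => ?_
    rw [mul_sub, ← hgf, ← mul_assoc, ← mul_assoc, hgf, sub_self]
  have hgm : ∀ x y, g (x * y) = x * g y := by
    intro x y
    rw [← sub_eq_zero]
    refine hR.1 _ fun z => ?_
    rw [sub_mul, hgf, mul_assoc, mul_assoc, hgf, sub_self]
  exact ⟨Multiplier.mk' f g hfm hgm hgf, multiplier_ext X hR fun x a => (hf x a).symm⟩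

end SmashProduct

end

/-- For the dual action of `B` on `R # A`, the fixed points in `M(R # A)` are precisely the image of
`M(R)` under the canonical embedding `π`. -/
theorem proposition7p3
    {A : Type u} [NonUnitalRing A] [Module ℂ A] [IsScalarTower ℂ A A] [SMulCommClass ℂ A A]
    {B : Type w} [NonUnitalRing B] [Module ℂ B] [IsScalarTower ℂ B B] [SMulCommClass ℂ B B]
    {R : Type v} [NonUnitalRing R] [Module ℂ R] [IsScalarTower ℂ R R] [SMulCommClass ℂ R R]
    (HA : RegularMultiplierHopfAlgebra A) (HB : RegularMultiplierHopfAlgebra B)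
    (P : DualPair HA HB) (hR : NondegenerateProduct R) (X : ModuleAlgebra HA R) :
    ∃ π : Multiplier R →ₐ[ℂ] Multiplier (SmashProduct X),
      SmashProduct.IsCanonicalEmbedding X π ∧ Function.Injective π ∧
        fixedPoints HB (dualAction P X) = Set.range π := by
  refine ⟨SmashProduct.embedHom X hR, SmashProduct.embed_left_mk X,
    SmashProduct.embedHom_injective X hR, Set.Subset.antisymm ?_ ?_⟩
  · exact fun m hm => SmashProduct.exists_embed_eq P X hR m hm
  · rintro _ ⟨m, rfl⟩
    exact SmashProduct.embed_mem_fixedPoints P X m
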